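/- **The minimal Gromov–Witten ring.** Consider formal symbols $\langle\tau_{d_1}H^{i_1},\dots,\tau_{d_{n-1}}H^{i_{n-1}},\tau_{d_n}H_r\rangle$ with $n\ge 1$ and all $d_s,i_s,r\in\mathbb Z_{\ge0}$ ($\tau_0$ is omitted); the degree of such a symbol is $\sum d_s+\sum i_s-r+3-n$. Symbols of negative degree, or with a negative descendant $d_s$ or a negative lower index, are read as $0$. Let $GW$ be the commutative $\mathbb C$-algebra generated by the symbols of non-negative degree subject to the following relations. 1. Invariance under permutations of the first $n-1$ insertions. 2. A symbol of degree $0$ equals $\frac{(d_1+\dots+d_n)!}{d_1!\cdots d_n!}$ if $\sum d_s=n-3$, and $0$ otherwise. 3. (String equation.) $\langle H^0,\tau_{d_1}H^{i_1},\dots,\tau_{d_n}H_r\rangle$ is the sum over $s=1,\dots,n$ of the symbols obtained by deleting $H^0$ and replacing $\tau_{d_s}$ by $\tau_{d_s-1}$, except for $\langle H^0,H^i,H_i\rangle$. 4. (Divisor axiom.) If $\langle H^1,\tau_{d_1}H^{i_1},\dots,\tau_{d_n}H_r\rangle$ has degree $d>0$, it equals $d\,\langle\tau_{d_1}H^{i_1},\dots,\tau_{d_n}H_r\rangle+\sum_{s<n}\langle\dots,\tau_{d_s-1}H^{i_s+1},\dots,\tau_{d_n}H_r\rangle+\langle\tau_{d_1}H^{i_1},\dots,\tau_{d_n-1}H_{r-1}\rangle$.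 5. (Topological recursion.) For every finite sequence $\Sigma$ of insertions $\tau_cH^i$, $$\langle\Sigma,\tau_{d_1}H^{j_1},\tau_{d_2}H^{j_2},\tau_{d_3}H_r\rangle=\sum\langle\tau_{d_1-1}H^{j_1},\Sigma_1,H_a\rangle\langle H^a,\Sigma_2,\tau_{d_2}H^{j_2},\tau_{d_3}H_r\rangle\quad(d_1\ge1),$$ $$\langle\Sigma,\tau_{d_1}H^{j_1},\tau_{d_2}H^{j_2},\tau_{d_3}H_r\rangle=\sum\langle\Sigma_1,\tau_{d_1}H^{j_1},\tau_{d_2}H^{j_2},H_a\rangle\langle H^a,\Sigma_2,\tau_{d_3-1}H_r\rangle\quad(d_3\ge1),$$ the sums being over all splittings $\Sigma=\Sigma_1\sqcup\Sigma_2$ and all $a\ge0$. **Rings and maps.** Let $A=\mathbb C[a_{ij}]$, $0\le i\le j$, $j>0$, and $A_N=\mathbb C[a_{ij}]$, $0\le i\le j\le N$, $j>0$; put $a_{00}=0$. Let $r\colon A\to GW$, $a_{ij}\mapsto\langle H,H^j,H_i\rangle$, and let $r_N\colon A\to A_N$ send $a_{ij}$ to $a_{ij}$ if $j\le N$ and to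 $0$ otherwise. Let $GW_N$ be the quotient of $GW$ by the ideal generated by all $\langle H,H^j,H_i\rangle$ with $i\le j$, $j>N$; the quotient map $GW\to GW_N$ is also denoted $r_N$. In $GW$ and $GW_N$ the letter $a_{ij}$ stands for the image of $a_{ij}$ under $r$. All these maps are applied to series coefficientwise. **Operators.** Let $R$ be $A_N$ or $GW_N$, let $D=q\frac{d}{dq}$, so that $Dq=qD+q$, and consider operators $P(q,D)$ with coefficients in $R$. For a matrix with entries in this ring, $\det_{\mathrm{right}}$ is the determinant expanded along the rightmost column, the entries standing to the left of their cofactors, which are again right determinants. Let $A^N$ (resp. $M$) be the $(N+1)\times(N+1)$ matrix, indexed by $0\le i,j\le N$, with entries $a_{ij}q^{j-i+1}$ (resp. $a_{ij}(Dq)^{j-i+1}$) for $i\le j$, $1$ for $i=j+1$ and $0$ for $i>j+1$. Put $L^Q_N=\det_{\mathrm{right}}(D-A^N)$ and let $L_N$ be the unique operator with $DL_N=\det_{\mathrm{right}}(D-M)$. **Series.** Operators act on $R[[q]][t]$, where $t$ stands for $\log q$, by $Dt=1$. For $F=\sum_s F^sh^s$ with $F^s\in R[[q]]$ put $F_k=\sum_{i=0}^kF^{k-i}\frac{t^i}{i!}$.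 We say that $F\bmod h^n$ is a perturbed solution of $P$ if $PF_k=0$ for all $k<n$. The regularization $\widetilde F$ of $F$ is obtained by multiplying, for each $d$, the coefficient of $q^d$ by $(h+1)\cdots(h+d)$. Let $$I=1+\sum_{i,j\ge0,\;d=i-j+2>0}\langle\tau_iH_j\rangle\,q^dh^j\in GW[[q]][[h]].$$ **Theorem.** (a) For every $N\ge0$, over $GW_N$: the abstract $I$-series $I^N=r_N(I)\bmod h^{N+1}$ is a perturbed solution of $L^Q_N$; the series $\widetilde I^N\bmod h^N$, where $\widetilde I^N=r_N(\widetilde I)$, is a perturbed solution of $L_N$; and $r_N(\widetilde I_0),\dots,r_N(\widetilde I_{N-1})$ form a basis of the $GW_N$-module of solutions of $L_N\Phi=0$ in $GW_N[[q]][\log q]$. (b) There is exactly one universal series $U\in A[[q]][[h]]$ with $U|_{q=0}=1$ and $r(U)=I$ such that for every $N\ge0$, over $A_N$: $r_N(U)\bmod h^{N+1}$ is a perturbed solution of $L^Q_N$; $r_N(\widetilde U)\bmod h^N$ is a perturbed solution of $L_N$; and, with $S_k=\widetilde U_k=\sum_{i=0}^k\widetilde U^{k-i}\frac{(\log q)^i}{i!}$,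 the restrictions $r_N(S_0),\dots,r_N(S_{N-1})$ form a basis of the $A_N$-module of solutions of $L_N\Phi=0$ in $A_N[[q]][\log q]$. -/

import Mathlib

open scoped Nat PowerSeries Polynomial

noncomputable section

namespace MinGW

/-! ### The minimal Gromov-Witten ring -/

/-- The formal symbol `⟨τ_{d₁}H^{i₁}, …, τ_{d_{n-1}}H^{i_{n-1}}, τ_d H_r⟩`.
The list `upper` holds the pairs `(d_s, i_s)`, `s = 1, …, n-1`; `n` is its length plus one. -/
structure GWSymbol where
  upper : List (ℕ × ℕ)
  d : ℕ
  r : ℕ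

/-- `∑ (d_s + i_s)` over a list of pairs `(d_s, i_s)`. -/
def weight (l : List (ℕ × ℕ)) : ℕ := (l.map fun p => p.1 + p.2).sum

/-- The degree `∑ d_s + ∑ i_s - r + (3 - n)` of a symbol. -/
def GWSymbol.deg (s : GWSymbol) : ℤ :=
  (weight s.upper : ℤ) + s.d - s.r + (3 - ((s.upper.length : ℤ) + 1))

/-- The polynomial ring on the symbols of non-negative degree. -/
abbrev SymbolRing : Type := MvPolynomial {s : GWSymbol // 0 ≤ s.deg} ℂ

/-- A symbol as an element of the polynomial ring; symbols of negative degree are read as `0`. -/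
def sym (l : List (ℕ × ℕ)) (d r : ℕ) : SymbolRing :=
  if h : 0 ≤ (GWSymbol.mk l d r).deg then MvPolynomial.X ⟨⟨l, d, r⟩, h⟩ else 0

theorem sym_eq_zero {l : List (ℕ × ℕ)} {d r : ℕ} (h : weight l + d + 2 < r) :
    sym l d r = 0 := by
  unfold sym
  rw [dif_neg]
  simp only [GWSymbol.deg]
  push Not
  omega

/-- The right side of the normalization: `(d₁ + ⋯ + d_n)! / (d₁! ⋯ d_n!)` if
`d₁ + ⋯ + d_n = n - 3`, and `0` otherwise. -/
def normValue (l : List (ℕ × ℕ)) (d : ℕ) : ℂ :=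
  if (l.map Prod.fst).sum + d + 3 = l.length + 1 then
    (((l.map Prod.fst).sum + d)! : ℂ) / (((l.map fun p => p.1 !).prod * d ! : ℕ) : ℂ)
  else 0

/-- The subsequence of `l` formed by the entries whose position lies in `S`. -/
def sel (l : List (ℕ × ℕ)) (S : Finset (Fin l.length)) : List (ℕ × ℕ) :=
  ((List.finRange l.length).filter (· ∈ S)).map l.get

/-- The relations of the minimal Gromov-Witten ring; `GWRel x` means that `x = 0` is imposed.
Terms with a negative descendant or with a negative lower index are `0`. -/
inductive GWRel : SymbolRing → Prop
  /-- Covariance under permutations of the upper insertions. -/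
  | perm (l l' : List (ℕ × ℕ)) (d r : ℕ) (h : l.Perm l') :
      GWRel (sym l d r - sym l' d r)
  /-- Normalization: the values of the symbols of degree zero. -/
  | norm (l : List (ℕ × ℕ)) (d r : ℕ) (h : (GWSymbol.mk l d r).deg = 0) :
      GWRel (sym l d r - MvPolynomial.C (normValue l d))
  /-- The string equation, except for `⟨H^0, H^i, H_i⟩`. -/
  | string (l : List (ℕ × ℕ)) (d r : ℕ) (h : ¬ (l = [(0, r)] ∧ d = 0)) :
      GWRel (sym ((0, 0) :: l) d r
        - ((∑ s : Fin l.length,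
              if l[s].1 = 0 then 0 else sym (l.set s (l[s].1 - 1, l[s].2)) d r)
            + if d = 0 then 0 else sym l (d - 1) r))
  /-- The divisor axiom in positive degree. -/
  | divisor (l : List (ℕ × ℕ)) (d r : ℕ) (h : 0 < (GWSymbol.mk ((0, 1) :: l) d r).deg) :
      GWRel (sym ((0, 1) :: l) d r
        - (((GWSymbol.mk ((0, 1) :: l) d r).deg : SymbolRing) * sym l d r
            + (∑ s : Fin l.length,
                if l[s].1 = 0 then 0 else sym (l.set s (l[s].1 - 1, l[s].2 + 1)) d r)
            + if d = 0 ∨ r = 0 then 0 else sym l (d - 1) (r - 1)))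
  /-- Topological recursion at an upper insertion `τ_{d₁+1}H^{j₁}`. The first factors vanish
  for `a` outside the range, their degree being negative. -/
  | trrUpper (l : List (ℕ × ℕ)) (d₁ j₁ d₂ j₂ d₃ r : ℕ) :
      GWRel (sym (l ++ [(d₁ + 1, j₁), (d₂, j₂)]) d₃ r
        - ∑ S : Finset (Fin l.length),
            ∑ a ∈ Finset.range (weight (l ++ [(d₁ + 1, j₁), (d₂, j₂)]) + 3),
              sym ((d₁, j₁) :: sel l S) 0 a * sym ((0, a) :: (sel l Sᶜ ++ [(d₂, j₂)])) d₃ r)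
  /-- Topological recursion at the last insertion `τ_{d₃+1}H_r`. -/
  | trrLower (l : List (ℕ × ℕ)) (d₁ j₁ d₂ j₂ d₃ r : ℕ) :
      GWRel (sym (l ++ [(d₁, j₁), (d₂, j₂)]) (d₃ + 1) r
        - ∑ S : Finset (Fin l.length),
            ∑ a ∈ Finset.range (weight (l ++ [(d₁, j₁), (d₂, j₂)]) + 3),
              sym (sel l S ++ [(d₁, j₁), (d₂, j₂)]) 0 a * sym ((0, a) :: sel l Sᶜ) d₃ r)

/-- The minimal Gromov-Witten ring. -/
abbrev GW : Type := SymbolRing ⧸ Ideal.span {x : SymbolRing | GWRel x}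

/-- The class of a symbol in `GW`. -/
def bracket (l : List (ℕ × ℕ)) (d r : ℕ) : GW := Ideal.Quotient.mk _ (sym l d r)

/-! ### The polynomial rings and the maps `r`, `r_N` -/

/-- `A = ℂ[a_ij]`, `0 ≤ i ≤ j`, `j > 0`. -/
abbrev A : Type := MvPolynomial {p : ℕ × ℕ // p.1 ≤ p.2 ∧ 0 < p.2} ℂ

/-- `A_N = ℂ[a_ij]`, `0 ≤ i ≤ j ≤ N`, `j > 0` (so `a_00 = 0`). -/
abbrev AN (N : ℕ) : Type := MvPolynomial {p : ℕ × ℕ // p.1 ≤ p.2 ∧ 0 < p.2 ∧ p.2 ≤ N} ℂ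

/-- The element `a_ij` of `A` for `i ≤ j`, with `a_00 = 0`. -/
def aElt (i j : ℕ) : A :=
  if h : i ≤ j ∧ 0 < j then MvPolynomial.X ⟨(i, j), h⟩ else 0

/-- The map `r : A → GW`, `a_ij ↦ ⟨H, H^j, H_i⟩`. -/
def rMap : A →ₐ[ℂ] GW := MvPolynomial.aeval fun p => bracket [(0, 1), (0, p.1.2)] 0 p.1.1

/-- The map `r_N : A → A_N`, `a_ij ↦ a_ij` for `i, j ≤ N` and `a_ij ↦ 0` otherwise. -/
def rN (N : ℕ) : A →ₐ[ℂ] AN N := MvPolynomial.aeval fun p =>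
  if h : p.1.2 ≤ N then MvPolynomial.X ⟨p.1, p.2.1, p.2.2, h⟩ else 0

/-- The ring `GW` in dimension `N`: all `⟨H, H^j, H_i⟩` with `i ≤ j`, `j > N` are set to `0`. -/
abbrev GWN (N : ℕ) : Type :=
  GW ⧸ Ideal.span {x : GW | ∃ i j : ℕ, i ≤ j ∧ N < j ∧ x = bracket [(0, 1), (0, j)] 0 i}

/-- The restriction `GW → GW_N`. -/
def toGWN (N : ℕ) : GW →ₐ[ℂ] GWN N := Ideal.Quotient.mkₐ ℂ _

/-! ### Differential operators -/

section Operators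

variable (R : Type*) [CommRing R]

/-- The letters `q` and `D = q d/dq`. -/
inductive Letter
  | q
  | D

/-- The commutation relation `D q = q D + q`. -/
inductive DRel : FreeAlgebra R Letter → FreeAlgebra R Letter → Prop
  | comm : DRel (FreeAlgebra.ι R Letter.D * FreeAlgebra.ι R Letter.q)
      (FreeAlgebra.ι R Letter.q * FreeAlgebra.ι R Letter.D + FreeAlgebra.ι R Letter.q)

/-- The algebra of differential operators `P(q, D)`, `D = q d/dq`, with coefficients in `R`,
in which elements of `R` are central. -/
abbrev DOp : Type _ := RingQuot (DRel R)

/-- The operator `q`. -/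
def qOp : DOp R := RingQuot.mkAlgHom R (DRel R) (FreeAlgebra.ι R Letter.q)

/-- The operator `D`. -/
def dOp : DOp R := RingQuot.mkAlgHom R (DRel R) (FreeAlgebra.ι R Letter.D)

theorem dOp_mul_qOp : dOp R * qOp R = qOp R * dOp R + qOp R := by
  have h := RingQuot.mkAlgHom_rel R (DRel.comm (R := R))
  simp only [map_mul, map_add] at h
  exact h

variable {R}

/-- An `R`-linear pair of endomorphisms `Q`, `Δ` with `Δ Q = Q Δ + Q` gives an action of the
operators, `q` acting as `Q` and `D` as `Δ`. -/
def opLift {M : Type*} [AddCommGroup M] [Module R M] (Q Δ : Module.End R M)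
    (h : Δ * Q = Q * Δ + Q) : DOp R →ₐ[R] Module.End R M :=
  RingQuot.liftAlgHom R ⟨FreeAlgebra.lift R (fun x => match x with
    | Letter.q => Q
    | Letter.D => Δ), by
      rintro _ _ ⟨⟩
      simpa using h⟩

theorem opLift_qOp {M : Type*} [AddCommGroup M] [Module R M] (Q Δ : Module.End R M)
    (h : Δ * Q = Q * Δ + Q) : opLift Q Δ h (qOp R) = Q := by
  simp [opLift, qOp]

theorem opLift_dOp {M : Type*} [AddCommGroup M] [Module R M] (Q Δ : Module.End R M)
    (h : Δ * Q = Q * Δ + Q) : opLift Q Δ h (dOp R) = Δ := by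
  simp [opLift, dOp]

theorem dOp_mul_qOp_pow (k : ℕ) :
    dOp R * qOp R ^ k = qOp R ^ k * (dOp R + (k : DOp R)) := by
  induction k with
  | zero => simp
  | succ k ih =>
    rw [pow_succ, ← mul_assoc, ih, mul_assoc, add_mul, dOp_mul_qOp, mul_assoc]
    congr 1
    rw [Nat.cast_succ, (Nat.cast_commute k (qOp R)).eq]
    noncomm_ring

/-- The operator `∑ q^k f_k(D)`. -/
def normalForm : (ℕ →₀ R[X]) →ₗ[R] DOp R :=
  Finsupp.lsum R fun k =>
    (LinearMap.mulLeft R (qOp R ^ k)).comp (Polynomial.aeval (dOp R)).toLinearMap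

/-- Left multiplication by `q` on normal forms. -/
def nfQ : Module.End R (ℕ →₀ R[X]) := Finsupp.lmapDomain R[X] R (· + 1)

/-- Left multiplication by `D` on normal forms. -/
def nfD : Module.End R (ℕ →₀ R[X]) :=
  Finsupp.lsum R fun k =>
    (Finsupp.lsingle k).comp (LinearMap.mulLeft R (Polynomial.X + (k : R[X])))

theorem nfD_single (k : ℕ) (f : R[X]) :
    nfD (Finsupp.single k f) = Finsupp.single k ((Polynomial.X + (k : R[X])) * f) := by
  simp [nfD]

theorem nfQ_single (k : ℕ) (f : R[X]) :
    nfQ (Finsupp.single k f) = Finsupp.single (k + 1) f := by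
  simp [nfQ]

theorem nf_comm : (nfD * nfQ : Module.End R (ℕ →₀ R[X])) = nfQ * nfD + nfQ := by
  apply Finsupp.lhom_ext
  intro k f
  simp only [Module.End.mul_apply, LinearMap.add_apply, nfD_single, nfQ_single,
    ← Finsupp.single_add]
  congr 1
  push_cast
  ring

theorem normalForm_nfQ (x : ℕ →₀ R[X]) : normalForm (nfQ x) = qOp R * normalForm x := by
  induction x using Finsupp.induction_linear with
  | zero => simp
  | add x y hx hy => simp only [map_add, hx, hy, mul_add]
  | single k f => simp only [nfQ_single, normalForm, Finsupp.lsum_single, LinearMap.comp_apply,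
      LinearMap.mulLeft_apply, pow_succ', mul_assoc]

theorem normalForm_nfD (x : ℕ →₀ R[X]) : normalForm (nfD x) = dOp R * normalForm x := by
  induction x using Finsupp.induction_linear with
  | zero => simp
  | add x y hx hy => simp only [map_add, hx, hy, mul_add]
  | single k f =>
    rw [nfD_single]
    simp only [normalForm, Finsupp.lsum_single, LinearMap.comp_apply,
      LinearMap.mulLeft_apply, AlgHom.toLinearMap_apply, map_mul, map_add, Polynomial.aeval_X,
      map_natCast, ← mul_assoc, dOp_mul_qOp_pow]

theorem normalForm_opLift (u : DOp R) (x : ℕ →₀ R[X]) :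
    normalForm (opLift nfQ nfD nf_comm u x) = u * normalForm x := by
  obtain ⟨w, rfl⟩ := RingQuot.mkAlgHom_surjective R (DRel R) u
  induction w using FreeAlgebra.induction generalizing x with
  | grade0 c =>
    simp only [AlgHom.commutes]
    simp [Algebra.smul_def]
  | grade1 y =>
    cases y with
    | q =>
      change normalForm (opLift nfQ nfD nf_comm (qOp R) x) = qOp R * normalForm x
      rw [opLift_qOp, normalForm_nfQ]
    | D =>
      change normalForm (opLift nfQ nfD nf_comm (dOp R) x) = dOp R * normalForm x
      rw [opLift_dOp, normalForm_nfD]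
  | mul a b ha hb =>
    simp only [map_mul, Module.End.mul_apply, ha, hb, mul_assoc]
  | add a b ha hb =>
    simp only [map_add, LinearMap.add_apply, ha, hb, add_mul]

theorem nfD_injective : Function.Injective (nfD : Module.End R (ℕ →₀ R[X])) := by
  rw [injective_iff_map_eq_zero]
  intro x hx
  have key : ∀ (x : ℕ →₀ R[X]) (k : ℕ), nfD x k = (Polynomial.X + (k : R[X])) * x k := by
    intro x k
    induction x using Finsupp.induction_linear with
    | zero => simp
    | add x y hx hy => simp only [map_add, Finsupp.add_apply, hx, hy, mul_add]
    | single m f =>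
      rw [nfD_single]
      by_cases h : m = k
      · subst h; simp
      · simp [h]
  ext1 k
  have h := key x k
  rw [hx] at h
  have hm : (Polynomial.X + (k : R[X])).Monic := by
    simpa using Polynomial.monic_X_add_C (k : R)
  have := (hm.mul_right_eq_zero_iff (p := Polynomial.X + (k : R[X])) (q := x k)).1 (by
    simpa using h.symm)
  simpa using this

/-- Multiplication by `D` on the left is injective. -/
theorem dOp_mul_left_cancel {u v : DOp R} (h : dOp R * u = dOp R * v) : u = v := by
  have one : (normalForm (Finsupp.single 0 1) : DOp R) = 1 := by simp [normalForm]
  have h1 := congrArg (fun w => opLift nfQ nfD nf_comm w (Finsupp.single 0 (1 : R[X]))) h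
  simp only [map_mul, Module.End.mul_apply, opLift_dOp] at h1
  have h2 := congrArg normalForm (nfD_injective h1)
  rwa [normalForm_opLift, normalForm_opLift, one, mul_one, mul_one] at h2

/-- The right determinant: expansion along the rightmost column, the entries standing to the left
of their cofactors, which are right determinants. -/
def detRight {S : Type*} [Ring S] : (n : ℕ) → Matrix (Fin n) (Fin n) S → S
  | 0, _ => 1
  | n + 1, M => ∑ i : Fin (n + 1), M i (Fin.last n) *
      ((-1) ^ ((i : ℕ) + n) * detRight n (M.submatrix i.succAbove Fin.castSucc))

/-- The matrix `D - A^N`, where `A^N` has the entries `a_ij q^{j-i+1}` for `i ≤ j`, `1` for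
`i = j + 1` and `0` for `i > j + 1`, with `0 ≤ i, j ≤ N`. -/
def quantumMatrix (a : ℕ → ℕ → R) (N : ℕ) : Matrix (Fin (N + 1)) (Fin (N + 1)) (DOp R) :=
  fun i j => (if i = j then dOp R else 0) -
    (if (i : ℕ) ≤ j then a i j • qOp R ^ ((j : ℕ) - i + 1)
      else if (i : ℕ) = j + 1 then 1 else 0)

/-- The quantum differential operator `L^Q_N`. -/
def opLQ (a : ℕ → ℕ → R) (N : ℕ) : DOp R := detRight (N + 1) (quantumMatrix a N)

/-- The matrix `D - M`, where `M` has the entries `a_ij (Dq)^{j-i+1}` for `i ≤ j`, `1` for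
`i = j + 1` and `0` for `i > j + 1`, with `0 ≤ i, j ≤ N`. -/
def regularMatrix (a : ℕ → ℕ → R) (N : ℕ) : Matrix (Fin (N + 1)) (Fin (N + 1)) (DOp R) :=
  fun i j => (if i = j then dOp R else 0) -
    (if (i : ℕ) ≤ j then a i j • (dOp R * qOp R) ^ ((j : ℕ) - i + 1)
      else if (i : ℕ) = j + 1 then 1 else 0)

theorem existsUnique_opL (a : ℕ → ℕ → R) (N : ℕ) :
    ∃! L : DOp R, dOp R * L = detRight (N + 1) (regularMatrix a N) := by
  refine existsUnique_of_exists_of_unique ?_ fun u v hu hv =>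
    dOp_mul_left_cancel (hu.trans hv.symm)
  have col : ∀ i : Fin (N + 1), regularMatrix a N i (Fin.last N) = dOp R *
      ((if i = Fin.last N then 1 else 0) -
        a i N • (qOp R * (dOp R * qOp R) ^ (N - (i : ℕ)))) := by
    intro i
    have hi : (i : ℕ) ≤ N := Nat.lt_succ_iff.1 i.2
    simp only [regularMatrix, Fin.val_last, hi, if_true]
    rw [mul_sub, mul_smul_comm, ← mul_assoc, ← pow_succ']
    split_ifs <;> simp
  refine ⟨∑ i : Fin (N + 1), ((if i = Fin.last N then 1 else 0) -
        a i N • (qOp R * (dOp R * qOp R) ^ (N - (i : ℕ)))) *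
      ((-1) ^ ((i : ℕ) + N) *
        detRight N ((regularMatrix a N).submatrix i.succAbove Fin.castSucc)), ?_⟩
  rw [detRight, Finset.mul_sum]
  refine Finset.sum_congr rfl fun i _ => ?_
  rw [col, mul_assoc]

/-- The operator `L_N`, determined by `det_right (D - M) = D L_N`. -/
def opL (a : ℕ → ℕ → R) (N : ℕ) : DOp R := (existsUnique_opL a N).choose

theorem dOp_mul_opL (a : ℕ → ℕ → R) (N : ℕ) :
    dOp R * opL a N = detRight (N + 1) (regularMatrix a N) :=
  (existsUnique_opL a N).choose_spec.1

/-! ### Series with logarithms and perturbed solutions -/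

/-- The operator `q d/dq` on `R[[q]]`. -/
def theta : R⟦X⟧ →ₗ[R] R⟦X⟧ :=
  (LinearMap.mulLeft R (PowerSeries.X : R⟦X⟧)).comp (PowerSeries.derivative R).toLinearMap

/-- The operator `D` on `R[[q]][t]`, where `t` stands for `log q`: the derivation with
`D q = q` and `D t = 1`. -/
def logD : Module.End R (R⟦X⟧)[X] where
  toFun p := p.sum (fun k f => Polynomial.monomial k (theta f)) + Polynomial.derivative p
  map_add' p p' := by
    rw [Polynomial.sum_add_index _ _ _ (by simp) (by simp), map_add]
    abel
  map_smul' c p := by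
    have h : ∀ (p : (R⟦X⟧)[X]) (k : ℕ),
        (p.sum (fun k f => Polynomial.monomial k (theta f))).coeff k = theta (p.coeff k) := by
      intro p k
      simp only [Polynomial.sum_def, Polynomial.finsetSum_coeff, Polynomial.coeff_monomial]
      rw [Finset.sum_ite_eq' p.support k]
      split_ifs with hk
      · rfl
      · rw [Polynomial.notMem_support_iff.1 hk, map_zero]
    ext1 k
    simp [h, Polynomial.coeff_derivative, smul_add, map_smul]

theorem coeff_logD (p : (R⟦X⟧)[X]) (k : ℕ) :
    (logD p).coeff k = theta (p.coeff k) + p.coeff (k + 1) * ((k : R⟦X⟧) + 1) := by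
  have h : (p.sum (fun k f => Polynomial.monomial k (theta f))).coeff k = theta (p.coeff k) := by
    simp only [Polynomial.sum_def, Polynomial.finsetSum_coeff, Polynomial.coeff_monomial]
    rw [Finset.sum_ite_eq' p.support k]
    split_ifs with hk
    · rfl
    · rw [Polynomial.notMem_support_iff.1 hk, map_zero]
  simp [logD, h, Polynomial.coeff_derivative]

/-- Multiplication by `q` on `R[[q]][t]`. -/
def logQ : Module.End R (R⟦X⟧)[X] :=
  LinearMap.mulLeft R (Polynomial.C (PowerSeries.X : R⟦X⟧))

theorem log_comm : (logD * logQ : Module.End R (R⟦X⟧)[X]) = logQ * logD + logQ := by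
  ext1 p
  ext1 k
  have h : ∀ f : R⟦X⟧, theta (PowerSeries.X * f) =
      PowerSeries.X * theta f + PowerSeries.X * f := by
    intro f
    change PowerSeries.X * PowerSeries.derivative R (PowerSeries.X * f) =
      PowerSeries.X * (PowerSeries.X * PowerSeries.derivative R f) + PowerSeries.X * f
    rw [Derivation.leibniz, PowerSeries.derivative_X, smul_eq_mul, smul_eq_mul]
    ring
  simp only [Module.End.mul_apply, LinearMap.add_apply, Polynomial.coeff_add, coeff_logD]
  simp only [logQ, LinearMap.mulLeft_apply, Polynomial.coeff_C_mul, coeff_logD, h]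
  ring

/-- The action of differential operators on `R[[q]][t]`. -/
def act : DOp R →ₐ[R] Module.End R (R⟦X⟧)[X] := opLift logQ logD log_comm

/-- For `I = ∑ I^s h^s`, `I^s ∈ R[[q]]`, the series with logarithms
`I_k = ∑_{i ≤ k} I^{k-i} t^i / i!`. -/
def pert [Algebra ℂ R] (F : R⟦X⟧⟦X⟧) (k : ℕ) : (R⟦X⟧)[X] :=
  ∑ i ∈ Finset.range (k + 1),
    ((i ! : ℂ)⁻¹) • Polynomial.monomial i (PowerSeries.coeff (k - i) F)

/-- `F mod h^n` is a perturbed solution of `P`: `P F_k = 0` for all `k < n`. -/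
def IsPerturbedSolution [Algebra ℂ R] (n : ℕ) (P : DOp R) (F : R⟦X⟧⟦X⟧) : Prop :=
  ∀ k < n, act P (pert F k) = 0

/-- The `R`-module of solutions of `P Φ = 0` in `R[[q]][t]`, `t = log q`. -/
def solutions (P : DOp R) : Submodule R (R⟦X⟧)[X] := LinearMap.ker (act P)

/-- The family `S` is a basis of the `R`-module of solutions of `P Φ = 0` in `R[[q]][log q]`. -/
def IsSolutionBasis {n : ℕ} (P : DOp R) (S : Fin n → (R⟦X⟧)[X]) : Prop :=
  LinearIndependent R S ∧ Submodule.span R (Set.range S) = solutions P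

/-! ### The `I`-series and its regularization -/

/-- The series `1 + ∑ c_ij q^d h^j` in `R[[q]][[h]]`, the sum being over `i, j ≥ 0` such that
`d = i - j + 2` is positive. The outer variable is `h`, the inner one is `q`. -/
def iSeries (c : ℕ → ℕ → R) : R⟦X⟧⟦X⟧ :=
  1 + PowerSeries.mk fun j => PowerSeries.mk fun d =>
    if 0 < d ∧ 2 ≤ d + j then c (d + j - 2) j else 0

/-- The regularization: the coefficient `F_d(h)` of `q^d` is replaced by
`F_d(h) (h + 1) ⋯ (h + d)`. -/
def regularize (F : R⟦X⟧⟦X⟧) : R⟦X⟧⟦X⟧ :=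
  PowerSeries.mk fun s => PowerSeries.mk fun d =>
    PowerSeries.coeff s ((PowerSeries.mk fun j => PowerSeries.coeff d (PowerSeries.coeff j F)) *
      ∏ k ∈ Finset.range d, ((PowerSeries.X : R⟦X⟧) + ((k + 1 : ℕ) : R⟦X⟧)))

end Operators

/-- Application of a ring homomorphism to the coefficients of a series in `q` and `h`. -/
abbrev mapSeries {R S : Type*} [CommRing R] [CommRing S] (f : R →+* S) : R⟦X⟧⟦X⟧ →+* S⟦X⟧⟦X⟧ :=
  PowerSeries.map (PowerSeries.map f)

/-- Application of a ring homomorphism to the coefficients of a series with logarithms. -/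
abbrev mapLog {R S : Type*} [CommRing R] [CommRing S] (f : R →+* S) : (R⟦X⟧)[X] →+* (S⟦X⟧)[X] :=
  Polynomial.mapRingHom (PowerSeries.map f)

/-- The `I`-series over `GW`, with the coefficients `⟨τ_i H_j⟩`. -/
def iGW : GW⟦X⟧⟦X⟧ := iSeries fun i j => bracket [] i j

/-- The coefficients `a_ij` in `A_N`. -/
def aN (N i j : ℕ) : AN N := rN N (aElt i j)

/-- The coefficients `⟨H, H^j, H_i⟩` in `GW_N` for `i ≤ j`, with `a_00 = 0`. -/
def aGWN (N i j : ℕ) : GWN N := toGWN N (rMap (aElt i j))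

end MinGW

end

/-!
The `I`-series is the first member of a sequence of series solving a first order system, and both
differential operators are eliminations of that system.

Put `Φ_j = h^j + ∑ ⟨H^j, τ_d H_r⟩ q^{j+d-r+1} h^r` over `GW`; by the string equation `Φ_0 = I`.
Evaluating `⟨H, H^j, τ_d H_r⟩` once by the divisor axiom and once by the topological recursion gives
`(D + h) Φ_j = Φ_{j+1} + ∑_{i ≤ j} a_ij q^{j-i+1} Φ_i` (`isFundamental_gwCoeff`). For degree reasons
the coefficient of `q^e h^r` in `Φ_j` vanishes if `0 < e` and `e + r ≤ j`. A sequence with these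
properties (`IsFundamental`) exists and is unique for any matrix `a` over any `ℂ`-algebra, because
its coefficients are determined by a recursion (`fundamental`, `IsFundamental.unique`), and it is
compatible with ring homomorphisms. The sequence over `A` therefore defines a universal series which
`r` maps to `I`.

The matrix `D - A^N` is a Hessenberg matrix, so its right determinants `Δ_k` satisfy
`Δ_{k+1} = D Δ_k - ∑ a_ik q^{k-i+1} Δ_i` (`hessDet_succ`). Hence, with `D` acting as `D + h`,
`Δ_k Φ_0 = Φ_k` and `L^Q_N Φ_0 = Φ_{N+1}`. If `a_ij = 0` for `j > N`, then `Φ_{N+1} = h^{N+1}`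
(`IsFundamental.toSeries_succ`). Since `F ↦ F_k` turns `D + h` into `D` (`act_pert`), this says that
`Φ_0 mod h^{N+1}` is a perturbed solution of `L^Q_N`. Regularization commutes with `D + h` and turns
`q` into `Dq` (`regularize_hQ`), so `D L_N` maps the regularization of `Φ_0` to `h^{N+1}`, and `L_N`
maps it to `h^N`.

For the basis, filter `R[[q]][log q]` by the order in `q`. Modulo higher order `Δ_k` acts as `D^k`,
which is injective in positive order and kills only polynomials in `log q` of degree less than `k`
in order zero. A solution of `L_N` is thus a combination of the regularized series with indices
`0, …, N`, and the last one does not occur as `L_N` maps it to `1` (`isSolutionBasis_of_hAct`). The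
same injectivity shows that a perturbed solution of `L^Q_N` is determined by its value at `q = 0`,
whence the uniqueness of the universal series.
-/

noncomputable section

namespace MinGW

/-! ### Right determinants of Hessenberg matrices -/

section Hessenberg

variable {S : Type*} [Ring S]

theorem detRight_succ (n : ℕ) (M : Matrix (Fin (n + 1)) (Fin (n + 1)) S) :
    detRight (n + 1) M = ∑ i : Fin (n + 1), M i (Fin.last n) *
      ((-1) ^ ((i : ℕ) + n) * detRight n (M.submatrix i.succAbove Fin.castSucc)) := rfl

theorem detRight_eq_zero_of_row (n : ℕ) (M : Matrix (Fin n) (Fin n) S) (i : Fin n)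
    (h : ∀ j, M i j = 0) : detRight n M = 0 := by
  induction n with
  | zero => exact i.elim0
  | succ n ih =>
    rw [detRight_succ]
    refine Finset.sum_eq_zero fun r _ => ?_
    by_cases hr : i = r
    · rw [← hr, h, zero_mul]
    · obtain ⟨i', hi'⟩ := Fin.exists_succAbove_eq hr
      rw [ih _ i' fun j => ?_, mul_zero, mul_zero]
      rw [Matrix.submatrix_apply, hi', h]

/-- The minors that occur in the expansion of a Hessenberg matrix along its last column: deleting
row `i` leaves a block triangular matrix, whose lower right block is triangular with `-1` on the
diagonal. -/
theorem detRight_hessenberg_minor (M : ℕ → ℕ → S) (hsub : ∀ j, M (j + 1) j = -1)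
    (hzero : ∀ i j, j + 1 < i → M i j = 0) (i m : ℕ) :
    detRight (i + m)
        (Matrix.of fun r c : Fin (i + m) => M (if (r : ℕ) < i then r else r + 1) c) =
      (-1) ^ m * detRight i (Matrix.of fun r c : Fin i => M r c) := by
  induction m with
  | zero =>
    rw [pow_zero, one_mul]
    congr 1
    ext r c
    rw [Matrix.of_apply, Matrix.of_apply, if_pos (by exact r.2)]
  | succ m ih =>
    refine (detRight_succ (i + m) _).trans ?_
    rw [Fin.sum_univ_castSucc, Finset.sum_eq_zero, zero_add]
    · rw [Matrix.of_apply, Fin.val_last, if_neg (by omega), hsub, ← two_mul, pow_mul, neg_one_sq,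
        one_pow, one_mul, pow_succ', mul_assoc, ← ih]
      congr 2
      ext r c
      simp
    · intro r _
      -- Any other minor keeps the last row, which vanishes off the last column.
      rw [detRight_eq_zero_of_row _ _ ⟨i + m - 1, by have := r.2; omega⟩, mul_zero, mul_zero]
      intro c
      have hr := r.2
      have hc := c.2
      simp only [Matrix.submatrix_apply, Fin.succAbove, Fin.lt_def, Fin.val_castSucc]
      apply hzero
      split_ifs <;> simp at * <;> omega

/-- Expansion of the right determinant of a Hessenberg matrix with `-1` below the diagonal. -/
theorem detRight_hessenberg_succ (M : ℕ → ℕ → S) (hsub : ∀ j, M (j + 1) j = -1)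
    (hzero : ∀ i j, j + 1 < i → M i j = 0) (k : ℕ) :
    detRight (k + 1) (Matrix.of fun r c : Fin (k + 1) => M r c) =
      ∑ i ∈ Finset.range (k + 1), M i k * detRight i (Matrix.of fun r c : Fin i => M r c) := by
  rw [detRight_succ, Finset.sum_range]
  refine Finset.sum_congr rfl fun ⟨i, hi⟩ _ => ?_
  obtain ⟨m, rfl⟩ := Nat.exists_eq_add_of_le (Nat.lt_succ_iff.1 hi)
  have key := detRight_hessenberg_minor M hsub hzero i m
  have hsubm : (Matrix.submatrix (Matrix.of fun r c : Fin (i + m + 1) => M r c)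
      (Fin.succAbove ⟨i, hi⟩) Fin.castSucc) =
      Matrix.of fun r c : Fin (i + m) => M (if (r : ℕ) < i then r else r + 1) c := by
    ext r c
    simp only [Matrix.submatrix_apply, Matrix.of_apply, Fin.succAbove, Fin.lt_def,
      Fin.val_castSucc]
    split_ifs <;> simp
  have hsign : ((-1 : S)) ^ (i + (i + m)) * (-1) ^ m = 1 := by
    rw [← pow_add, show i + (i + m) + m = 2 * (i + m) by ring, pow_mul, neg_one_sq, one_pow]
  rw [hsubm, key, ← mul_assoc ((-1) ^ _), hsign, one_mul, Matrix.of_apply, Fin.val_last]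

end Hessenberg

section Operators

variable {R : Type*} [CommRing R]

/-- The entries of the infinite Hessenberg matrix `D - (a_ij T^{j-i+1})` with `-1` below the
diagonal. The choices `T = q` and `T = Dq` give the matrices defining `L^Q_N` and `L_N`. -/
def hessEntry (T : DOp R) (a : ℕ → ℕ → R) (i j : ℕ) : DOp R :=
  (if i = j then dOp R else 0) -
    (if i ≤ j then a i j • T ^ (j - i + 1) else if i = j + 1 then 1 else 0)

/-- The right determinant of the upper left `k × k` block of `hessEntry T a`. -/
def hessDet (T : DOp R) (a : ℕ → ℕ → R) (k : ℕ) : DOp R :=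
  detRight k (Matrix.of fun i j : Fin k => hessEntry T a i j)

@[simp]
theorem hessDet_zero (T : DOp R) (a : ℕ → ℕ → R) : hessDet T a 0 = 1 := rfl

theorem hessDet_succ (T : DOp R) (a : ℕ → ℕ → R) (k : ℕ) :
    hessDet T a (k + 1) = dOp R * hessDet T a k -
      ∑ i ∈ Finset.range (k + 1), a i k • (T ^ (k - i + 1) * hessDet T a i) := by
  rw [hessDet, detRight_hessenberg_succ]
  · change ∑ i ∈ Finset.range (k + 1), hessEntry T a i k * hessDet T a i = _
    have : ∀ i ∈ Finset.range (k + 1), hessEntry T a i k * hessDet T a i =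
        (if i = k then dOp R * hessDet T a k else 0) -
          a i k • (T ^ (k - i + 1) * hessDet T a i) := by
      intro i hi
      rw [hessEntry, if_pos (Nat.lt_succ_iff.1 (Finset.mem_range.1 hi)), sub_mul,
        smul_mul_assoc]
      split_ifs with h
      · rw [h]
      · rw [zero_mul]
    rw [Finset.sum_congr rfl this, Finset.sum_sub_distrib]
    simp [hessDet]
  · intro j
    simp [hessEntry]
  · intro i j h
    simp [hessEntry, show i ≠ j by omega, show ¬ i ≤ j by omega, show i ≠ j + 1 by omega]

theorem opLQ_eq_hessDet (a : ℕ → ℕ → R) (N : ℕ) : opLQ a N = hessDet (qOp R) a (N + 1) := by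
  unfold opLQ hessDet
  congr 1
  ext i j
  simp [quantumMatrix, hessEntry, Fin.ext_iff]

theorem dOp_mul_opL_eq_hessDet (a : ℕ → ℕ → R) (N : ℕ) :
    dOp R * opL a N = hessDet (dOp R * qOp R) a (N + 1) := by
  rw [dOp_mul_opL]
  unfold hessDet
  congr 1
  ext i j
  simp [regularMatrix, hessEntry, Fin.ext_iff]

/-! ### The action on series in `q` and `h` -/

theorem coeff_theta (f : R⟦X⟧) (d : ℕ) :
    PowerSeries.coeff d (theta f) = (d : R) * PowerSeries.coeff d f := by
  change PowerSeries.coeff d (PowerSeries.X * PowerSeries.derivative R f) = _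
  cases d with
  | zero => simp
  | succ d => rw [PowerSeries.coeff_succ_X_mul, PowerSeries.coeff_derivative]; push_cast; ring

/-- The coefficient of `q^d` in a series in `q` and `h`, a series in `h`. -/
def qCoeff (d : ℕ) : R⟦X⟧⟦X⟧ →ₗ[R] R⟦X⟧ where
  toFun F := PowerSeries.mk fun j => PowerSeries.coeff d (PowerSeries.coeff j F)
  map_add' F G := by ext; simp
  map_smul' c F := by ext; simp

@[simp]
theorem coeff_qCoeff (d j : ℕ) (F : R⟦X⟧⟦X⟧) :
    PowerSeries.coeff j (qCoeff d F) = PowerSeries.coeff d (PowerSeries.coeff j F) := by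
  simp [qCoeff]

theorem ext_qCoeff {F G : R⟦X⟧⟦X⟧} (h : ∀ d, qCoeff d F = qCoeff d G) : F = G := by
  ext j d
  rw [← coeff_qCoeff, h, coeff_qCoeff]

/-- The operator `D + h`, by which `D` acts on `q^h F` for a series `F` in `q` and `h`. -/
def hD : Module.End R R⟦X⟧⟦X⟧ where
  toFun F := (PowerSeries.mk fun j => theta (PowerSeries.coeff j F)) + PowerSeries.X * F
  map_add' F G := by
    ext
    simp [mul_add]
    ring
  map_smul' c F := by
    ext j d
    cases j <;> simp [PowerSeries.coeff_succ_X_mul]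

/-- Multiplication by `q`. -/
def hQ : Module.End R R⟦X⟧⟦X⟧ := LinearMap.mulLeft R (PowerSeries.C PowerSeries.X)

theorem coeff_hD_zero (F : R⟦X⟧⟦X⟧) :
    PowerSeries.coeff 0 (hD F) = theta (PowerSeries.coeff 0 F) := by simp [hD]

theorem coeff_hD_succ (F : R⟦X⟧⟦X⟧) (j : ℕ) : PowerSeries.coeff (j + 1) (hD F) =
    theta (PowerSeries.coeff (j + 1) F) + PowerSeries.coeff j F := by
  simp [hD, PowerSeries.coeff_succ_X_mul]

theorem coeff_hQ (F : R⟦X⟧⟦X⟧) (j : ℕ) :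
    PowerSeries.coeff j (hQ F) = PowerSeries.X * PowerSeries.coeff j F := by
  simp [hQ]

theorem qCoeff_hD (d : ℕ) (F : R⟦X⟧⟦X⟧) :
    qCoeff d (hD F) = (PowerSeries.X + (d : R⟦X⟧)) * qCoeff d F := by
  ext j
  rw [coeff_qCoeff, add_mul, ← map_natCast (PowerSeries.C (R := R)), map_add,
    PowerSeries.coeff_C_mul]
  cases j with
  | zero => simp [coeff_hD_zero, coeff_theta]
  | succ j => simp [coeff_hD_succ, coeff_theta, PowerSeries.coeff_succ_X_mul, add_comm]

theorem qCoeff_zero_hQ (F : R⟦X⟧⟦X⟧) : qCoeff 0 (hQ F) = 0 := by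
  ext j
  simp [coeff_hQ]

theorem qCoeff_succ_hQ (d : ℕ) (F : R⟦X⟧⟦X⟧) : qCoeff (d + 1) (hQ F) = qCoeff d F := by
  ext j
  simp [coeff_hQ, PowerSeries.coeff_succ_X_mul]

theorem hD_hQ_comm : (hD * hQ : Module.End R R⟦X⟧⟦X⟧) = hQ * hD + hQ := by
  ext1 F
  refine ext_qCoeff fun d => ?_
  cases d with
  | zero => simp [qCoeff_hD, qCoeff_zero_hQ]
  | succ d =>
    simp only [Module.End.mul_apply, LinearMap.add_apply, map_add, qCoeff_hD, qCoeff_succ_hQ]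
    push_cast
    ring

/-- The action of differential operators on `R[[q]][[h]]` in which `D` acts as `D + h`. -/
def hAct : DOp R →ₐ[R] Module.End R R⟦X⟧⟦X⟧ := opLift hQ hD hD_hQ_comm

@[simp]
theorem hAct_dOp : hAct (dOp R) = hD := opLift_dOp _ _ _

@[simp]
theorem hAct_qOp : hAct (qOp R) = hQ := opLift_qOp _ _ _

@[simp]
theorem act_dOp : act (dOp R) = logD := opLift_dOp _ _ _

@[simp]
theorem act_qOp : act (qOp R) = logQ := opLift_qOp _ _ _

theorem qCoeff_hQ_pow_of_lt {d m : ℕ} (h : d < m) (F : R⟦X⟧⟦X⟧) :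
    qCoeff d ((hQ ^ m) F) = 0 := by
  induction m generalizing d with
  | zero => omega
  | succ m ih =>
    rw [pow_succ', Module.End.mul_apply]
    cases d with
    | zero => exact qCoeff_zero_hQ _
    | succ d => rw [qCoeff_succ_hQ, ih (by omega)]

theorem qCoeff_hQ_pow_of_le {d m : ℕ} (h : m ≤ d) (F : R⟦X⟧⟦X⟧) :
    qCoeff d ((hQ ^ m) F) = qCoeff (d - m) F := by
  induction m generalizing d with
  | zero => simp
  | succ m ih =>
    obtain ⟨d, rfl⟩ := Nat.exists_eq_succ_of_ne_zero (show d ≠ 0 by omega)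
    rw [pow_succ', Module.End.mul_apply, qCoeff_succ_hQ, ih (by omega)]
    simp

/-- A sequence of series solving the first order system with matrix `a_ij T^{j-i+1}` arises from
its first member by applying the right determinants. -/
theorem hAct_hessDet {T : DOp R} {a : ℕ → ℕ → R} {Φ : ℕ → R⟦X⟧⟦X⟧}
    (hΦ : ∀ j, hD (Φ j) = Φ (j + 1) +
      ∑ i ∈ Finset.range (j + 1), a i j • (hAct T ^ (j - i + 1)) (Φ i)) (k : ℕ) :
    hAct (hessDet T a k) (Φ 0) = Φ k := by
  induction k using Nat.strong_induction_on with
  | _ k ih =>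
    cases k with
    | zero => simp
    | succ k =>
      rw [hessDet_succ]
      simp only [map_sub, map_sum, map_smul, map_mul, map_pow, LinearMap.sub_apply,
        LinearMap.sum_apply, LinearMap.smul_apply, Module.End.mul_apply, hAct_dOp]
      rw [ih k (by omega), hΦ, sub_eq_iff_eq_add]
      congr 1
      refine Finset.sum_congr rfl fun i hi => ?_
      rw [ih i (Finset.mem_range.1 hi)]

/-! ### Regularization -/

theorem qCoeff_regularize (d : ℕ) (F : R⟦X⟧⟦X⟧) : qCoeff d (regularize F) =
    qCoeff d F * ∏ k ∈ Finset.range d, ((PowerSeries.X : R⟦X⟧) + ((k + 1 : ℕ) : R⟦X⟧)) := by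
  ext s
  rw [coeff_qCoeff, regularize, PowerSeries.coeff_mk, PowerSeries.coeff_mk]
  rfl

theorem regularize_add (F G : R⟦X⟧⟦X⟧) :
    regularize (F + G) = regularize F + regularize G :=
  ext_qCoeff fun d => by simp only [qCoeff_regularize, map_add, add_mul]

theorem regularize_smul (c : R) (F : R⟦X⟧⟦X⟧) : regularize (c • F) = c • regularize F :=
  ext_qCoeff fun d => by simp only [qCoeff_regularize, map_smul, smul_mul_assoc]

theorem regularize_sum {ι : Type*} (s : Finset ι) (F : ι → R⟦X⟧⟦X⟧) :
    regularize (∑ i ∈ s, F i) = ∑ i ∈ s, regularize (F i) :=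
  ext_qCoeff fun d => by simp only [qCoeff_regularize, map_sum, Finset.sum_mul]

theorem regularize_hD (F : R⟦X⟧⟦X⟧) : regularize (hD F) = hD (regularize F) :=
  ext_qCoeff fun d => by simp only [qCoeff_regularize, qCoeff_hD, mul_assoc]

/-- Regularization turns multiplication by `q` into `Dq`. -/
theorem regularize_hQ (F : R⟦X⟧⟦X⟧) : regularize (hQ F) = hD (hQ (regularize F)) :=
  ext_qCoeff fun d => by
    cases d with
    | zero => simp [qCoeff_regularize, qCoeff_hD, qCoeff_zero_hQ]
    | succ d =>
      simp only [qCoeff_regularize, qCoeff_hD, qCoeff_succ_hQ, Finset.prod_range_succ]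
      ring

theorem regularize_hQ_pow (m : ℕ) (F : R⟦X⟧⟦X⟧) :
    regularize ((hQ ^ m) F) = (hAct (dOp R * qOp R) ^ m) (regularize F) := by
  induction m with
  | zero => rfl
  | succ m ih =>
    rw [pow_succ', pow_succ', Module.End.mul_apply, Module.End.mul_apply, regularize_hQ, ih,
      map_mul, Module.End.mul_apply, hAct_dOp, hAct_qOp]

/-! ### Series with logarithms -/

section Complex

variable [Algebra ℂ R]

theorem coeff_pert (F : R⟦X⟧⟦X⟧) (k i : ℕ) : (pert F k).coeff i =
    if i ≤ k then ((i ! : ℂ)⁻¹) • PowerSeries.coeff (k - i) F else 0 := by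
  simp only [pert, Polynomial.finsetSum_coeff, Polynomial.coeff_smul, Polynomial.coeff_monomial,
    smul_ite, smul_zero, Finset.sum_ite_eq', Finset.mem_range, Nat.lt_succ_iff]

theorem theta_complex_smul (c : ℂ) (f : R⟦X⟧) : theta (c • f) = c • theta f := by
  ext d
  simp [coeff_theta]

/-- The map `F ↦ F_k` turns `D + h` into `D`. -/
theorem logD_pert (F : R⟦X⟧⟦X⟧) (k : ℕ) : logD (pert F k) = pert (hD F) k := by
  ext1 i
  rw [coeff_logD, coeff_pert, coeff_pert, coeff_pert]
  rcases lt_trichotomy i k with h | h | h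
  · obtain ⟨m, rfl⟩ := Nat.exists_eq_add_of_lt h
    rw [if_pos (by omega), if_pos (by omega), if_pos (by omega),
      show i + m + 1 - i = m + 1 by omega, show i + m + 1 - (i + 1) = m by omega,
      coeff_hD_succ, theta_complex_smul, smul_add, Nat.factorial_succ]
    congr 1
    have hc : ((i : R⟦X⟧) + 1) = ((i + 1 : ℕ) : ℂ) • (1 : R⟦X⟧) := by
      rw [Nat.cast_smul_eq_nsmul]; simp
    have h1 : ((i + 1 : ℕ) : ℂ) ≠ 0 := Nat.cast_ne_zero.2 (by omega)
    have h2 : ((i ! : ℕ) : ℂ) ≠ 0 := Nat.cast_ne_zero.2 (Nat.factorial_ne_zero _)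
    rw [hc, mul_smul_comm, mul_one, smul_smul]
    congr 1
    push_cast at h1 ⊢
    field_simp
  · subst h
    simp [coeff_hD_zero]
  · rw [if_neg (by omega), if_neg (by omega), if_neg (by omega)]
    simp

theorem logQ_pert (F : R⟦X⟧⟦X⟧) (k : ℕ) : logQ (pert F k) = pert (hQ F) k := by
  ext1 i
  simp only [logQ, LinearMap.mulLeft_apply, Polynomial.coeff_C_mul, coeff_pert, coeff_hQ]
  split_ifs <;> simp

/-- The map `F ↦ F_k` as a linear map. -/
def pertₗ (k : ℕ) : R⟦X⟧⟦X⟧ →ₗ[R] (R⟦X⟧)[X] where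
  toFun F := pert F k
  map_add' F G := by
    ext1 i
    simp only [Polynomial.coeff_add, coeff_pert]
    split_ifs <;> simp
  map_smul' c F := by
    ext1 i
    simp only [RingHom.id_apply, Polynomial.coeff_smul, coeff_pert]
    split_ifs
    · simp only [PowerSeries.coeff_smul, smul_comm c]
    · simp

/-- The map `F ↦ F_k` intertwines the two actions of differential operators. -/
theorem act_pert (P : DOp R) (F : R⟦X⟧⟦X⟧) (k : ℕ) : act P (pert F k) = pert (hAct P F) k := by
  obtain ⟨w, rfl⟩ := RingQuot.mkAlgHom_surjective R (DRel R) P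
  induction w using FreeAlgebra.induction generalizing F with
  | grade0 c =>
    simp only [AlgHom.commutes, Module.algebraMap_end_apply]
    exact ((pertₗ k).map_smul c F).symm
  | grade1 y =>
    cases y with
    | q =>
      change act (qOp R) _ = pert (hAct (qOp R) F) k
      rw [act_qOp, hAct_qOp, logQ_pert]
    | D =>
      change act (dOp R) _ = pert (hAct (dOp R) F) k
      rw [act_dOp, hAct_dOp, logD_pert]
  | mul a b ha hb => simp only [map_mul, Module.End.mul_apply, ha, hb]
  | add a b ha hb =>
    simp only [map_add, LinearMap.add_apply, ha, hb]
    exact ((pertₗ k).map_add _ _).symm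

end Complex

end Operators

section Solutions

variable {R : Type*} [CommRing R]

theorem isUnit_natCast [Algebra ℂ R] {n : ℕ} (hn : n ≠ 0) : IsUnit (n : R) := by
  rw [← map_natCast (algebraMap ℂ R)]
  exact (IsUnit.mk0 _ (Nat.cast_ne_zero.2 hn)).map _

/-! ### The fundamental system -/

/-- The functions `u e r j`, read as the coefficients of `q^e h^r` in series `Φ_j`, form a
fundamental system for `a` if `Φ_j` specializes to `h^j` at `q = 0`, is congruent to `h^j` modulo
`(q, h)^{j+1}`, and satisfies
`(D + h) Φ_j = Φ_{j+1} + ∑_{i ≤ j} a_ij q^{j-i+1} Φ_i`. The last equation is required only where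
it is not a consequence of the vanishing. -/
structure IsFundamental (a : ℕ → ℕ → R) (u : ℕ → ℕ → ℕ → R) : Prop where
  zero : ∀ r j, u 0 r j = if r = j then 1 else 0
  vanish : ∀ e r j : ℕ, 0 < e → e + r ≤ j → u e r j = 0
  eqn : ∀ e r j : ℕ, 0 < e → j < e + r →
    (e : R) * u e r j + (if r = 0 then 0 else u e (r - 1) j) = u e r (j + 1) +
      ∑ i : Fin (j + 1), if j + 1 - i ≤ e then a i j * u (e - (j + 1 - i)) r i else 0

theorem IsFundamental.map {S : Type*} [CommRing S] {a : ℕ → ℕ → R} {u : ℕ → ℕ → ℕ → R}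
    (h : IsFundamental a u) (f : R →+* S) :
    IsFundamental (fun i j => f (a i j)) (fun e r j => f (u e r j)) where
  zero r j := by
    rw [h.zero, apply_ite f, map_one, map_zero]
  vanish e r j he hj := by rw [h.vanish e r j he hj, map_zero]
  eqn e r j he hj := by
    have := congrArg f (h.eqn e r j he hj)
    simpa only [map_add, map_mul, map_natCast, map_sum, apply_ite f, map_zero] using this

/-- The equation of a fundamental system solved for the coefficient of `q^e h^r` in `Φ_j`. The
recursion decreases `e`, then `r`, then `e + r - j`. -/
def fundamental [Algebra ℂ R] (a : ℕ → ℕ → R) (e r j : ℕ) : R :=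
  if _he : e = 0 then if r = j then 1 else 0
  else if _hj : j < e + r then
    ((e : ℂ)⁻¹) • ((fundamental a e r (j + 1) + ∑ i : Fin (j + 1),
      if j + 1 - i ≤ e then a i j * fundamental a (e - (j + 1 - i)) r i else 0)
      - if _hr : r = 0 then 0 else fundamental a e (r - 1) j)
  else 0
termination_by (e, r, e + r - j)
decreasing_by
  · exact Prod.Lex.right _ (Prod.Lex.right _ (by omega))
  · exact Prod.Lex.left _ _ (by have := i.2; omega)
  · exact Prod.Lex.right _ (Prod.Lex.left _ _ (by omega))

theorem isFundamental_fundamental [Algebra ℂ R] (a : ℕ → ℕ → R) :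
    IsFundamental a (fundamental a) where
  zero r j := by rw [fundamental, dif_pos rfl]
  vanish e r j he hj := by rw [fundamental, dif_neg he.ne', dif_neg (by omega)]
  eqn e r j he hj := by
    have h1 : ((e : R)) = (e : ℂ) • (1 : R) := by
      rw [Nat.cast_smul_eq_nsmul, nsmul_eq_mul, mul_one]
    rw [fundamental.eq_def a e r j, dif_neg he.ne', dif_pos hj, h1, smul_mul_assoc, one_mul,
      smul_smul, mul_inv_cancel₀ (Nat.cast_ne_zero.2 he.ne'), one_smul]
    simp only [dite_eq_ite]
    rw [sub_add_cancel]

theorem IsFundamental.unique [Algebra ℂ R] {a : ℕ → ℕ → R} {u v : ℕ → ℕ → ℕ → R}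
    (hu : IsFundamental a u) (hv : IsFundamental a v) : u = v := by
  suffices ∀ e r n j, e + r ≤ n + j → u e r j = v e r j by
    ext e r j
    exact this e r (e + r) j (by omega)
  intro e
  induction e using Nat.strong_induction_on with
  | _ e ihe =>
    rcases Nat.eq_zero_or_pos e with rfl | he
    · intro r n j _
      rw [hu.zero, hv.zero]
    intro r
    induction r using Nat.strong_induction_on with
    | _ r ihr =>
      intro n
      induction n with
      | zero => intro j hj; rw [hu.vanish e r j he (by omega), hv.vanish e r j he (by omega)]
      | succ n ihn =>
        intro j hj
        rcases Nat.lt_or_ge j (e + r) with hlt | hge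
        swap
        · rw [hu.vanish e r j he hge, hv.vanish e r j he hge]
        have h1 := hu.eqn e r j he hlt
        have h2 := hv.eqn e r j he hlt
        have h3 : (if r = 0 then 0 else u e (r - 1) j) = if r = 0 then 0 else v e (r - 1) j := by
          split_ifs with hr
          · rfl
          · exact ihr (r - 1) (by omega) (e + (r - 1)) j (by omega)
        have h4 : (∑ i : Fin (j + 1),
            if j + 1 - i ≤ e then a i j * u (e - (j + 1 - i)) r i else 0) =
            ∑ i : Fin (j + 1),
              if j + 1 - i ≤ e then a i j * v (e - (j + 1 - i)) r i else 0 := by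
          refine Finset.sum_congr rfl fun i _ => ?_
          rw [ihe (e - (j + 1 - i)) (by have := i.2; omega) r (e + r) i (by omega)]
        rw [ihn (j + 1) (by omega), h4, ← h2, h3] at h1
        exact (isUnit_natCast he.ne').mul_left_cancel (add_right_cancel h1)

/-- The series `∑ u e r j q^e h^r`. -/
def toSeries (u : ℕ → ℕ → ℕ → R) (j : ℕ) : R⟦X⟧⟦X⟧ :=
  PowerSeries.mk fun r => PowerSeries.mk fun e => u e r j

theorem coeff_qCoeff_toSeries (u : ℕ → ℕ → ℕ → R) (j e r : ℕ) :
    PowerSeries.coeff r (qCoeff e (toSeries u j)) = u e r j := by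
  simp [toSeries]

theorem IsFundamental.qCoeff_zero {a : ℕ → ℕ → R} {u : ℕ → ℕ → ℕ → R} (h : IsFundamental a u)
    (j : ℕ) : qCoeff 0 (toSeries u j) = PowerSeries.X ^ j := by
  ext r
  rw [coeff_qCoeff_toSeries, h.zero, PowerSeries.coeff_X_pow]

/-- The equation holds for all coefficients: for `e = 0` and for `e + r ≤ j` it follows from the
other two conditions. -/
theorem IsFundamental.eqn' {a : ℕ → ℕ → R} {u : ℕ → ℕ → ℕ → R} (h : IsFundamental a u)
    (e r j : ℕ) :
    (e : R) * u e r j + (if r = 0 then 0 else u e (r - 1) j) = u e r (j + 1) +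
      ∑ i : Fin (j + 1), if j + 1 - i ≤ e then a i j * u (e - (j + 1 - i)) r i else 0 := by
  rcases Nat.eq_zero_or_pos e with rfl | he
  · rw [Finset.sum_eq_zero fun i _ => if_neg (by have := i.2; omega)]
    simp only [h.zero]
    rcases Nat.eq_zero_or_pos r with rfl | hr
    · simp
    · simp only [hr.ne', if_false, Nat.cast_zero, zero_mul, zero_add, add_zero]
      congr 1
      exact propext ⟨by omega, by omega⟩
  rcases Nat.lt_or_ge j (e + r) with hlt | hge
  · exact h.eqn e r j he hlt
  · rw [h.vanish e r j he hge, h.vanish e r (j + 1) he (by omega), Finset.sum_eq_zero]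
    · split_ifs
      · simp
      · rw [h.vanish e (r - 1) j he (by omega)]; simp
    · intro i _
      have := i.2
      split_ifs with hi
      · rcases Nat.eq_zero_or_pos (e - (j + 1 - i)) with h0 | h0
        · rw [h0, h.zero, if_neg (by omega), mul_zero]
        · rw [h.vanish _ _ _ h0 (by omega), mul_zero]
      · rfl

/-- The quantum differential system satisfied by a fundamental system. -/
theorem IsFundamental.hD_toSeries {a : ℕ → ℕ → R} {u : ℕ → ℕ → ℕ → R} (h : IsFundamental a u)
    (j : ℕ) : hD (toSeries u j) = toSeries u (j + 1) +
      ∑ i ∈ Finset.range (j + 1), a i j • (hQ ^ (j - i + 1)) (toSeries u i) := by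
  refine ext_qCoeff fun e => ?_
  ext r
  have key := h.eqn' e r j
  rw [← Fin.sum_univ_eq_sum_range (fun i => a i j • (hQ ^ (j - i + 1)) (toSeries u i))]
  rw [qCoeff_hD, add_mul, ← map_natCast (PowerSeries.C (R := R)), map_add,
    PowerSeries.coeff_C_mul, coeff_qCoeff_toSeries, map_add, map_add, coeff_qCoeff_toSeries,
    map_sum, map_sum, add_comm]
  convert key using 2
  · cases r with
    | zero => simp
    | succ r => simp [PowerSeries.coeff_succ_X_mul, toSeries]
  · refine Finset.sum_congr rfl fun i _ => ?_
    have hi := i.2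
    rw [map_smul, map_smul, smul_eq_mul, show j - (i : ℕ) + 1 = j + 1 - i by omega]
    split_ifs with hle
    · rw [qCoeff_hQ_pow_of_le hle, coeff_qCoeff_toSeries]
    · rw [qCoeff_hQ_pow_of_lt (by omega), map_zero, mul_zero]

theorem isUnit_X_add_natCast [Algebra ℂ R] {e : ℕ} (he : e ≠ 0) :
    IsUnit (PowerSeries.X + (e : R⟦X⟧)) := by
  rw [PowerSeries.isUnit_iff_constantCoeff]
  simpa using isUnit_natCast he

/-- If all `a_ij` with `j > N` vanish, the member `Φ_{N+1}` of a fundamental system is constant: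
then `Φ_{N+1+m} = (D + h)^m Φ_{N+1}`, and for `e > 0` the coefficient of `q^e` in the left side is
divisible by an arbitrarily high power of `h`, while `e + h` is a unit. -/
theorem IsFundamental.toSeries_succ [Algebra ℂ R] {a : ℕ → ℕ → R} {u : ℕ → ℕ → ℕ → R}
    (h : IsFundamental a u) {N : ℕ} (ha : ∀ i j, i ≤ j → N < j → a i j = 0) :
    toSeries u (N + 1) = PowerSeries.X ^ (N + 1) := by
  have hstep : ∀ e m, qCoeff e (toSeries u (N + 1 + m)) =
      (PowerSeries.X + (e : R⟦X⟧)) ^ m * qCoeff e (toSeries u (N + 1)) := by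
    intro e m
    induction m with
    | zero => simp
    | succ m ih =>
      have := h.hD_toSeries (N + 1 + m)
      rw [Finset.sum_eq_zero, add_zero] at this
      · rw [← add_assoc, ← this, qCoeff_hD, ih, pow_succ', mul_assoc]
      · intro i hi
        rw [ha i _ (Nat.lt_succ_iff.1 (Finset.mem_range.1 hi)) (by omega), zero_smul]
  refine ext_qCoeff fun e => ?_
  rcases Nat.eq_zero_or_pos e with rfl | he
  · rw [h.qCoeff_zero]
    ext r
    simp only [coeff_qCoeff, PowerSeries.coeff_X_pow]
    split_ifs <;> simp
  · ext r
    have hdvd : (PowerSeries.X : R⟦X⟧) ^ (r + 1) ∣ qCoeff e (toSeries u (N + 1)) := by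
      rw [← ((isUnit_X_add_natCast he.ne').pow (e + r)).dvd_mul_left, ← hstep,
        PowerSeries.X_pow_dvd_iff]
      intro s hs
      rw [coeff_qCoeff_toSeries, h.vanish _ _ _ he (by omega)]
    rw [PowerSeries.X_pow_dvd_iff.1 hdvd r (by omega), coeff_qCoeff, PowerSeries.coeff_X_pow]
    split_ifs
    · rw [PowerSeries.coeff_one, if_neg he.ne']
    · simp

/-! ### The operators applied to the universal series -/

theorem qCoeff_X_pow (e k : ℕ) :
    qCoeff e (PowerSeries.X ^ k : R⟦X⟧⟦X⟧) = if e = 0 then PowerSeries.X ^ k else 0 := by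
  ext r
  rw [coeff_qCoeff, PowerSeries.coeff_X_pow]
  split_ifs with h1 h2 h2 <;> simp [PowerSeries.coeff_one, PowerSeries.coeff_X_pow, h1, h2]

theorem regularize_X_pow (k : ℕ) :
    regularize (PowerSeries.X ^ k : R⟦X⟧⟦X⟧) = PowerSeries.X ^ k :=
  ext_qCoeff fun e => by
    rw [qCoeff_regularize, qCoeff_X_pow]
    split_ifs with h
    · simp [h]
    · simp

section

variable [Algebra ℂ R] {a : ℕ → ℕ → R} {u : ℕ → ℕ → ℕ → R} {N : ℕ}

theorem IsFundamental.hAct_opLQ (h : IsFundamental a u)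
    (ha : ∀ i j, i ≤ j → N < j → a i j = 0) :
    hAct (opLQ a N) (toSeries u 0) = PowerSeries.X ^ (N + 1) := by
  rw [opLQ_eq_hessDet, hAct_hessDet (Φ := toSeries u), h.toSeries_succ ha]
  intro j
  rw [hAct_qOp]
  exact h.hD_toSeries j

theorem IsFundamental.hD_hAct_opL (h : IsFundamental a u)
    (ha : ∀ i j, i ≤ j → N < j → a i j = 0) :
    hD (hAct (opL a N) (regularize (toSeries u 0))) = PowerSeries.X ^ (N + 1) := by
  rw [← hAct_dOp, ← Module.End.mul_apply, ← map_mul, dOp_mul_opL_eq_hessDet,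
    hAct_hessDet (Φ := fun j => regularize (toSeries u j)), h.toSeries_succ ha, regularize_X_pow]
  intro j
  simp only [← regularize_hD, h.hD_toSeries j, regularize_add, regularize_sum, regularize_smul,
    regularize_hQ_pow]

theorem eq_X_pow_of_hD_eq {G : R⟦X⟧⟦X⟧} (h : hD G = PowerSeries.X ^ (N + 1)) :
    G = PowerSeries.X ^ N := by
  refine ext_qCoeff fun e => ?_
  have h1 := congrArg (qCoeff e) h
  rw [qCoeff_hD, qCoeff_X_pow] at h1
  rw [qCoeff_X_pow]
  split_ifs at h1 ⊢ with he
  · subst he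
    rw [Nat.cast_zero, add_zero, pow_succ'] at h1
    exact PowerSeries.X_mul_cancel h1
  · exact (isUnit_X_add_natCast he).mul_left_cancel (by rw [h1, mul_zero])

theorem IsFundamental.hAct_opL (h : IsFundamental a u)
    (ha : ∀ i j, i ≤ j → N < j → a i j = 0) :
    hAct (opL a N) (regularize (toSeries u 0)) = PowerSeries.X ^ N :=
  eq_X_pow_of_hD_eq (h.hD_hAct_opL ha)

theorem pert_X_pow {k n : ℕ} (hk : k ≤ n) :
    pert (PowerSeries.X ^ n : R⟦X⟧⟦X⟧) k = if k = n then 1 else 0 := by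
  ext1 i
  rw [coeff_pert, PowerSeries.coeff_X_pow]
  rcases Nat.eq_zero_or_pos i with rfl | hi
  · rw [if_pos (Nat.zero_le k), Nat.sub_zero]
    split_ifs <;> simp
  · have h1 : (if k = n then 1 else 0 : (R⟦X⟧)[X]).coeff i = 0 := by
      split_ifs <;> simp [Polynomial.coeff_one, hi.ne']
    rw [h1]
    split_ifs with h2 h3
    · omega
    · simp
    · rfl

theorem IsFundamental.isPerturbedSolution_opLQ (h : IsFundamental a u)
    (ha : ∀ i j, i ≤ j → N < j → a i j = 0) :
    IsPerturbedSolution (N + 1) (opLQ a N) (toSeries u 0) := fun k hk => by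
  rw [act_pert, h.hAct_opLQ ha, pert_X_pow hk.le, if_neg hk.ne]

theorem IsFundamental.isPerturbedSolution_opL (h : IsFundamental a u)
    (ha : ∀ i j, i ≤ j → N < j → a i j = 0) :
    IsPerturbedSolution N (opL a N) (regularize (toSeries u 0)) := fun k hk => by
  rw [act_pert, h.hAct_opL ha, pert_X_pow hk.le, if_neg hk.ne]

end

/-! ### Filtration of the series with logarithms by the order in `q` -/

/-- The series with logarithms whose order in `q` is at least `d`. -/
def qFil (R : Type*) [CommRing R] (d : ℕ) : Submodule R (R⟦X⟧)[X] where
  carrier := {p | ∀ i, ∀ e < d, PowerSeries.coeff e (p.coeff i) = 0}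
  zero_mem' := by simp
  add_mem' hp hp' i e he := by rw [Polynomial.coeff_add, map_add, hp i e he, hp' i e he, add_zero]
  smul_mem' c p hp i e he := by
    rw [Polynomial.coeff_smul, PowerSeries.coeff_smul, hp i e he, smul_zero]

theorem mem_qFil {d : ℕ} {p : (R⟦X⟧)[X]} :
    p ∈ qFil R d ↔ ∀ i, ∀ e < d, PowerSeries.coeff e (p.coeff i) = 0 := Iff.rfl

theorem qFil_zero : qFil R 0 = ⊤ := by
  ext p
  simp [mem_qFil]

theorem qFil_anti {d d' : ℕ} (h : d ≤ d') : qFil R d' ≤ qFil R d :=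
  fun _ hp i e he => hp i e (by omega)

theorem eq_zero_of_forall_mem_qFil {p : (R⟦X⟧)[X]} (h : ∀ d, p ∈ qFil R d) : p = 0 := by
  ext i e
  simpa using h (e + 1) i e (by omega)

theorem coeff_coeff_logD (p : (R⟦X⟧)[X]) (i e : ℕ) :
    PowerSeries.coeff e ((logD p).coeff i) = (e : R) * PowerSeries.coeff e (p.coeff i) +
      ((i + 1 : ℕ) : R) * PowerSeries.coeff e (p.coeff (i + 1)) := by
  have : ((i : R⟦X⟧) + 1) = PowerSeries.C ((i + 1 : ℕ) : R) := by simp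
  rw [coeff_logD, map_add, coeff_theta, this, PowerSeries.coeff_mul_C]
  ring

theorem logD_mem_qFil {d : ℕ} {p : (R⟦X⟧)[X]} (h : p ∈ qFil R d) : logD p ∈ qFil R d :=
  fun i e he => by rw [coeff_coeff_logD, h i e he, h (i + 1) e he]; simp

theorem logQ_mem_qFil {d : ℕ} {p : (R⟦X⟧)[X]} (h : p ∈ qFil R d) : logQ p ∈ qFil R (d + 1) := by
  intro i e he
  rw [logQ, LinearMap.mulLeft_apply, Polynomial.coeff_C_mul]
  cases e with
  | zero => simp
  | succ e => rw [PowerSeries.coeff_succ_X_mul, h i e (by omega)]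

/-- An operator raises the order in `q`. Both `q` and `Dq` do. -/
def RaisesOrder (T : DOp R) : Prop := ∀ d, ∀ p ∈ qFil R d, act T p ∈ qFil R (d + 1)

theorem raisesOrder_qOp : RaisesOrder (qOp R) := fun d p hp => by
  rw [act_qOp]
  exact logQ_mem_qFil hp

theorem raisesOrder_dOp_mul_qOp : RaisesOrder (dOp R * qOp R) := fun d p hp => by
  rw [map_mul, Module.End.mul_apply, act_qOp, act_dOp]
  exact logD_mem_qFil (logQ_mem_qFil hp)

theorem RaisesOrder.pow_succ {T : DOp R} (hT : RaisesOrder T) (m : ℕ) :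
    RaisesOrder (T ^ (m + 1)) := by
  induction m with
  | zero => simpa using hT
  | succ m ih =>
    intro d p hp
    rw [_root_.pow_succ', map_mul, Module.End.mul_apply]
    exact qFil_anti (by omega) (hT _ _ (ih d p hp))

theorem act_hessDet_succ (T : DOp R) (a : ℕ → ℕ → R) (k : ℕ) (p : (R⟦X⟧)[X]) :
    act (hessDet T a (k + 1)) p = logD (act (hessDet T a k) p) -
      ∑ i ∈ Finset.range (k + 1), a i k • act (T ^ (k - i + 1)) (act (hessDet T a i) p) := by
  rw [hessDet_succ]
  simp only [map_sub, map_sum, map_smul, map_mul, LinearMap.sub_apply, LinearMap.sum_apply,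
    LinearMap.smul_apply, Module.End.mul_apply, act_dOp]

theorem act_hessDet_mem_qFil {T : DOp R} (hT : RaisesOrder T) (a : ℕ → ℕ → R) {d : ℕ}
    {p : (R⟦X⟧)[X]} (hp : p ∈ qFil R d) (k : ℕ) : act (hessDet T a k) p ∈ qFil R d := by
  induction k using Nat.strong_induction_on with
  | _ k ih =>
    cases k with
    | zero => simpa using hp
    | succ k =>
      rw [act_hessDet_succ]
      refine sub_mem (logD_mem_qFil (ih k (by omega))) (sum_mem fun i hi => ?_)
      refine Submodule.smul_mem _ _ (qFil_anti (Nat.le_succ d) (hT.pow_succ _ _ _ (ih i ?_)))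
      exact Finset.mem_range.1 hi

/-- Modulo higher order in `q`, the right determinant of size `k` acts as `D^k`. -/
theorem logD_act_hessDet_sub_mem {T : DOp R} (hT : RaisesOrder T) (a : ℕ → ℕ → R) {d : ℕ}
    {p : (R⟦X⟧)[X]} (hp : p ∈ qFil R d) (k : ℕ) :
    logD (act (hessDet T a k) p) - act (hessDet T a (k + 1)) p ∈ qFil R (d + 1) := by
  rw [act_hessDet_succ, sub_sub_cancel]
  exact sum_mem fun i _ => Submodule.smul_mem _ _
    (hT.pow_succ _ _ _ (act_hessDet_mem_qFil hT a hp i))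

section

variable [Algebra ℂ R]

/-- On `q^d R[t]` with `d > 0`, the operator `D = d + d/dt` is injective: look at the top
coefficient. -/
theorem mem_qFil_succ_of_logD {d : ℕ} (hd : d ≠ 0) {p : (R⟦X⟧)[X]} (hp : p ∈ qFil R d)
    (h : logD p ∈ qFil R (d + 1)) : p ∈ qFil R (d + 1) := by
  suffices ∀ n i, p.natDegree < n + i → PowerSeries.coeff d (p.coeff i) = 0 by
    intro i e he
    rcases Nat.lt_succ_iff_lt_or_eq.1 he with he | rfl
    · exact hp i e he
    · exact this (p.natDegree + 1) i (by omega)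
  intro n
  induction n with
  | zero => intro i hi; rw [Polynomial.coeff_eq_zero_of_natDegree_lt (by omega), map_zero]
  | succ n ih =>
    intro i hi
    have h1 := h i d (by omega)
    rw [coeff_coeff_logD, ih (i + 1) (by omega), mul_zero, add_zero] at h1
    exact (isUnit_natCast hd).mul_left_cancel (by rw [h1, mul_zero])

theorem mem_qFil_succ_of_act_hessDet {T : DOp R} (hT : RaisesOrder T) (a : ℕ → ℕ → R) {d : ℕ}
    (hd : d ≠ 0) {p : (R⟦X⟧)[X]} (hp : p ∈ qFil R d) (k : ℕ)
    (h : act (hessDet T a k) p ∈ qFil R (d + 1)) : p ∈ qFil R (d + 1) := by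
  induction k with
  | zero => simpa using h
  | succ k ih =>
    refine ih (mem_qFil_succ_of_logD hd (act_hessDet_mem_qFil hT a hp k) ?_)
    simpa using add_mem (logD_act_hessDet_sub_mem hT a hp k) h

/-- A solution of positive order in `q` vanishes. -/
theorem eq_zero_of_act_hessDet {T : DOp R} (hT : RaisesOrder T) (a : ℕ → ℕ → R)
    {p : (R⟦X⟧)[X]} (hp : p ∈ qFil R 1) (k : ℕ) (h : act (hessDet T a k) p = 0) : p = 0 := by
  have key : ∀ d, p ∈ qFil R (d + 1) := by
    intro d
    induction d with
    | zero => exact hp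
    | succ d ih =>
      refine mem_qFil_succ_of_act_hessDet hT a (by omega) ih k ?_
      rw [h]
      exact zero_mem _
  exact eq_zero_of_forall_mem_qFil fun d => qFil_anti (Nat.le_succ d) (key d)

/-- The value at `q = 0` of a series annihilated modulo `q` by the right determinant of size `k`
is a polynomial in `log q` of degree less than `k`; more precisely, `k` derivatives bring the
degree from below `n + k` to below `n`. -/
theorem coeff_zero_eq_zero_of_act_hessDet {T : DOp R} (hT : RaisesOrder T) (a : ℕ → ℕ → R)
    (p : (R⟦X⟧)[X]) (k n : ℕ)
    (h : ∀ i, n ≤ i → PowerSeries.coeff 0 ((act (hessDet T a k) p).coeff i) = 0)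
    (i : ℕ) (hi : n + k ≤ i) : PowerSeries.coeff 0 (p.coeff i) = 0 := by
  induction k generalizing n with
  | zero => simpa using h i hi
  | succ k ih =>
    refine ih (n + 1) (fun i hi => ?_) (by omega)
    obtain ⟨i, rfl⟩ := Nat.exists_eq_succ_of_ne_zero (show i ≠ 0 by omega)
    have h1 := logD_act_hessDet_sub_mem hT a (d := 0) (p := p) (by simp [qFil_zero]) k i 0
      one_pos
    rw [Polynomial.coeff_sub, map_sub, h i (by omega), sub_zero, coeff_coeff_logD, Nat.cast_zero,
      zero_mul, zero_add] at h1
    exact (isUnit_natCast (Nat.succ_ne_zero i)).mul_left_cancel (by rw [h1, mul_zero])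

end

end Solutions

/-! ### Bases of solutions -/

section Basis

variable {R : Type*} [CommRing R] [Algebra ℂ R]

theorem coeff_zero_coeff_pert {F : R⟦X⟧⟦X⟧} (hF : qCoeff 0 F = 1) (k i : ℕ) :
    PowerSeries.coeff 0 ((pert F k).coeff i) = if i = k then ((i ! : ℂ)⁻¹) • (1 : R) else 0 := by
  have h : ∀ j, PowerSeries.coeff 0 (PowerSeries.coeff j F) = if j = 0 then 1 else 0 := by
    intro j
    rw [← coeff_qCoeff, hF, PowerSeries.coeff_one]
  rw [coeff_pert]
  rcases lt_trichotomy i k with h1 | h1 | h1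
  · rw [if_pos h1.le, if_neg h1.ne, PowerSeries.coeff_smul, h, if_neg (by omega), smul_zero]
  · rw [if_pos h1.le, if_pos h1, PowerSeries.coeff_smul, h, if_pos (by omega)]
  · rw [if_neg (by omega), if_neg h1.ne', map_zero]

theorem factorial_mul_inv_smul (i : ℕ) : ((i ! : ℕ) : R) * ((i ! : ℂ)⁻¹ • (1 : R)) = 1 := by
  have h1 : ((i ! : ℕ) : R) = ((i ! : ℕ) : ℂ) • (1 : R) := by
    rw [Nat.cast_smul_eq_nsmul, nsmul_eq_mul, mul_one]
  rw [h1, smul_mul_assoc, one_mul, smul_smul,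
    mul_inv_cancel₀ (Nat.cast_ne_zero.2 (Nat.factorial_ne_zero i)), one_smul]

/-- If `F` has the value `1` at `q = 0` and `L F = h^N`, where `D L` is a right determinant of size
`N + 1`, then the series `F_0, …, F_{N-1}` form a basis of the solutions of `L`. Any solution
of `L` is a solution of `D L`, hence a combination of `F_0, …, F_N`; since `L F_N = 1`, the last
series does not occur. -/
theorem isSolutionBasis_of_hAct {T : DOp R} (hT : RaisesOrder T) {a : ℕ → ℕ → R} {N : ℕ}
    {L : DOp R} (hL : dOp R * L = hessDet T a (N + 1)) {F : R⟦X⟧⟦X⟧} (hF : qCoeff 0 F = 1)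
    (hLF : hAct L F = PowerSeries.X ^ N) :
    IsSolutionBasis L (fun k : Fin N => pert F k) := by
  have hact : ∀ k ≤ N, act L (pert F k) = if k = N then 1 else 0 := fun k hk => by
    rw [act_pert, hLF, pert_X_pow hk]
  constructor
  · rw [Fintype.linearIndependent_iff]
    intro g hg i
    have h1 := congrArg (fun p : (R⟦X⟧)[X] => PowerSeries.coeff 0 (p.coeff i)) hg
    simp only [Polynomial.finsetSum_coeff, Polynomial.coeff_smul, map_sum, PowerSeries.coeff_smul,
      coeff_zero_coeff_pert hF, Polynomial.coeff_zero, map_zero, smul_eq_mul] at h1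
    rw [Finset.sum_eq_single i (fun k _ hk => by
      rw [if_neg (fun h => hk (Fin.ext h.symm)), mul_zero]) (by simp), if_pos rfl] at h1
    calc g i = g i * (((i : ℕ)! : ℕ) * (((i : ℕ)! : ℂ)⁻¹ • (1 : R))) := by
          rw [factorial_mul_inv_smul, mul_one]
      _ = (((i : ℕ)! : ℕ) : R) * (g i * (((i : ℕ)! : ℂ)⁻¹ • (1 : R))) := by ring
      _ = 0 := by rw [h1, mul_zero]
  · apply le_antisymm
    · rw [Submodule.span_le]
      rintro _ ⟨k, rfl⟩
      change act L (pert F k) = 0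
      rw [hact k k.2.le, if_neg k.2.ne]
    · intro p hp
      change act L p = 0 at hp
      set c : ℕ → R := fun i => ((i ! : ℕ) : R) * PowerSeries.coeff 0 (p.coeff i) with hc
      have hdet : act (hessDet T a (N + 1)) p = 0 := by
        rw [← hL, map_mul, Module.End.mul_apply, hp, map_zero]
      have hdeg : ∀ i, N + 1 ≤ i → PowerSeries.coeff 0 (p.coeff i) = 0 := fun i hi =>
        coeff_zero_eq_zero_of_act_hessDet hT a p (N + 1) 0 (by simp [hdet]) i (by omega)
      have hsum : p - ∑ k ∈ Finset.range (N + 1), c k • pert F k = 0 := by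
        refine eq_zero_of_act_hessDet hT a ?_ (N + 1) ?_
        · intro i e he
          obtain rfl : e = 0 := by omega
          simp only [Polynomial.coeff_sub, Polynomial.finsetSum_coeff, Polynomial.coeff_smul,
            map_sub, map_sum, PowerSeries.coeff_smul, coeff_zero_coeff_pert hF, smul_ite,
            smul_zero, Finset.sum_ite_eq, Finset.mem_range]
          split_ifs with hi
          · rw [hc, smul_eq_mul, mul_right_comm, factorial_mul_inv_smul, one_mul, sub_self]
          · rw [hdeg i (by omega), sub_zero]
        · rw [map_sub, hdet, zero_sub, neg_eq_zero, map_sum]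
          refine Finset.sum_eq_zero fun k hk => ?_
          rw [map_smul, ← hL, map_mul, Module.End.mul_apply,
            hact k (Nat.lt_succ_iff.1 (Finset.mem_range.1 hk)), act_dOp]
          have : (logD (1 : (R⟦X⟧)[X])) = 0 := by
            ext i e
            rw [coeff_coeff_logD]
            rcases Nat.eq_zero_or_pos e with rfl | he
            · simp [Polynomial.coeff_one]
            · rcases Nat.eq_zero_or_pos i with rfl | hi
              · simp [Polynomial.coeff_one, PowerSeries.coeff_one, he.ne']
              · simp [Polynomial.coeff_one, hi.ne']
          split_ifs <;> simp [this]
      rw [sub_eq_zero] at hsum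
      have hcN : c N = 0 := by
        have h1 := hp
        rw [hsum, map_sum, Finset.sum_range_succ, Finset.sum_eq_zero, zero_add, map_smul,
          hact N le_rfl, if_pos rfl] at h1
        · simpa using congrArg (fun p : (R⟦X⟧)[X] => PowerSeries.coeff 0 (p.coeff 0)) h1
        · intro k hk
          have hk' := Finset.mem_range.1 hk
          rw [map_smul, hact k hk'.le, if_neg hk'.ne, smul_zero]
      rw [hsum, Finset.sum_range_succ, hcN, zero_smul, add_zero]
      exact sum_mem fun k hk => Submodule.smul_mem _ _
        (Submodule.subset_span ⟨⟨k, Finset.mem_range.1 hk⟩, rfl⟩)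

theorem IsFundamental.isSolutionBasis_opL {a : ℕ → ℕ → R} {u : ℕ → ℕ → ℕ → R}
    (h : IsFundamental a u) {N : ℕ} (ha : ∀ i j, i ≤ j → N < j → a i j = 0) :
    IsSolutionBasis (opL a N) (fun k : Fin N => pert (regularize (toSeries u 0)) k) := by
  refine isSolutionBasis_of_hAct raisesOrder_dOp_mul_qOp (dOp_mul_opL_eq_hessDet a N) ?_
    (h.hAct_opL ha)
  rw [qCoeff_regularize, h.qCoeff_zero]
  simp

/-- A perturbed solution of `L^Q_N` is determined by its value at `q = 0`. -/
theorem coeff_eq_of_isPerturbedSolution {a : ℕ → ℕ → R} {N : ℕ} {F G : R⟦X⟧⟦X⟧}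
    (hF : IsPerturbedSolution (N + 1) (opLQ a N) F)
    (hG : IsPerturbedSolution (N + 1) (opLQ a N) G) (h0 : qCoeff 0 F = qCoeff 0 G) {k : ℕ}
    (hk : k ≤ N) : PowerSeries.coeff k F = PowerSeries.coeff k G := by
  have h : pert F k - pert G k = 0 := by
    refine eq_zero_of_act_hessDet raisesOrder_qOp a ?_ (N + 1) ?_
    · intro i e he
      obtain rfl : e = 0 := by omega
      have h1 := congrArg (PowerSeries.coeff (k - i)) h0
      rw [coeff_qCoeff, coeff_qCoeff] at h1
      rw [Polynomial.coeff_sub, map_sub, coeff_pert, coeff_pert]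
      split_ifs
      · rw [PowerSeries.coeff_smul, PowerSeries.coeff_smul, h1, sub_self]
      · rw [sub_self]
    · rw [← opLQ_eq_hessDet, map_sub, hF k (by omega), hG k (by omega), sub_zero]
  have h1 := congrArg (fun p : (R⟦X⟧)[X] => p.coeff 0) (sub_eq_zero.1 h)
  simpa [coeff_pert] using h1

/-! ### Change of coefficients -/

variable {S : Type*} [CommRing S] [Algebra ℂ S]

theorem mapLog_pert (f : R →ₐ[ℂ] S) (F : R⟦X⟧⟦X⟧) (k : ℕ) :
    mapLog f.toRingHom (pert F k) = pert (mapSeries f.toRingHom F) k := by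
  ext i e
  simp only [mapLog, Polynomial.coe_mapRingHom, Polynomial.coeff_map, coeff_pert,
    PowerSeries.coeff_map]
  split_ifs
  · simp only [PowerSeries.coeff_map, PowerSeries.coeff_smul]
    exact map_smul f _ _
  · simp

end Basis

section Map

variable {R S : Type*} [CommRing R] [CommRing S]

theorem qCoeff_mapSeries (f : R →+* S) (d : ℕ) (F : R⟦X⟧⟦X⟧) :
    qCoeff d (mapSeries f F) = PowerSeries.map f (qCoeff d F) := by
  ext
  simp

theorem mapSeries_regularize (f : R →+* S) (F : R⟦X⟧⟦X⟧) :
    mapSeries f (regularize F) = regularize (mapSeries f F) :=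
  ext_qCoeff fun d => by
    simp only [qCoeff_mapSeries, qCoeff_regularize, map_mul, map_prod, map_add, PowerSeries.map_X,
      map_natCast]

theorem mapSeries_toSeries (f : R →+* S) (u : ℕ → ℕ → ℕ → R) (j : ℕ) :
    mapSeries f (toSeries u j) = toSeries (fun e r j => f (u e r j)) j := by
  ext
  simp [toSeries]

end Map

/-- The perturbed solutions and the basis of solutions obtained from the image under `f` of the
first member of a fundamental system, if `f` kills all `a_ij` with `j > N`. -/
theorem IsFundamental.solutions_map {R S : Type*} [CommRing R] [Algebra ℂ R] [CommRing S]
    [Algebra ℂ S] {a : ℕ → ℕ → R} {u : ℕ → ℕ → ℕ → R} (h : IsFundamental a u) (f : R →ₐ[ℂ] S)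
    {b : ℕ → ℕ → S} (hb : ∀ i j, f (a i j) = b i j) {N : ℕ}
    (hN : ∀ i j, i ≤ j → N < j → b i j = 0) :
    IsPerturbedSolution (N + 1) (opLQ b N) (mapSeries f.toRingHom (toSeries u 0)) ∧
    IsPerturbedSolution N (opL b N) (mapSeries f.toRingHom (regularize (toSeries u 0))) ∧
    IsSolutionBasis (opL b N)
      (fun k : Fin N => mapLog f.toRingHom (pert (regularize (toSeries u 0)) k)) := by
  obtain rfl : (fun i j => f (a i j)) = b := by ext i j; exact hb i j
  have h' := h.map f.toRingHom
  simp only [mapLog_pert, mapSeries_regularize, mapSeries_toSeries]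
  exact ⟨h'.isPerturbedSolution_opLQ hN, h'.isPerturbedSolution_opL hN,
    h'.isSolutionBasis_opL hN⟩

/-! ### The fundamental system of the Gromov-Witten ring -/

section GWRing

theorem mk_eq_of_rel {x y : SymbolRing} (h : GWRel (x - y)) :
    Ideal.Quotient.mk (Ideal.span {x : SymbolRing | GWRel x}) x = Ideal.Quotient.mk _ y :=
  Ideal.Quotient.eq.2 (Ideal.subset_span h)

theorem bracket_eq_zero {l : List (ℕ × ℕ)} {d r : ℕ}
    (h : (GWSymbol.mk l d r).deg < 0) : bracket l d r = 0 := by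
  rw [bracket, sym, dif_neg (by omega), map_zero]

/-- A two-point symbol of degree zero vanishes. -/
theorem bracket_two_eq_zero {j d r : ℕ} (h : j + d + 1 ≤ r) : bracket [(0, j)] d r = 0 := by
  rcases h.lt_or_eq with h | h
  · exact bracket_eq_zero (by simp [GWSymbol.deg, weight]; omega)
  · have := mk_eq_of_rel (GWRel.norm [(0, j)] d r (by simp [GWSymbol.deg, weight]; omega))
    rw [bracket, this, normValue, if_neg (by simp), map_zero, map_zero]

theorem bracket_three_eq_one (j : ℕ) : bracket [(0, 1), (0, j)] 0 (j + 1) = 1 := by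
  have := mk_eq_of_rel (GWRel.norm [(0, 1), (0, j)] 0 (j + 1)
    (by simp [GWSymbol.deg, weight]; omega))
  rw [bracket, this]
  simp [normValue]

theorem bracket_three_eq_zero {j r : ℕ} (h : j + 1 < r) : bracket [(0, 1), (0, j)] 0 r = 0 :=
  bracket_eq_zero (by simp [GWSymbol.deg, weight]; omega)

theorem rMap_aElt {i j : ℕ} (h : i ≤ j) :
    rMap (aElt i j) = bracket [(0, 1), (0, j)] 0 i := by
  rcases Nat.eq_zero_or_pos j with rfl | hj
  · obtain rfl : i = 0 := by omega
    -- Here `a_00 = 0`, and `⟨H, H^0, H_0⟩ = 0` by the string equation.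
    rw [aElt, dif_neg (by omega), map_zero]
    have h1 := mk_eq_of_rel (GWRel.perm [(0, 1), (0, 0)] [(0, 0), (0, 1)] 0 0
      (List.Perm.swap _ _ _))
    have h2 := mk_eq_of_rel (GWRel.string [(0, 1)] 0 0 (by simp))
    rw [bracket, h1, h2]
    simp
  · rw [aElt, dif_pos ⟨h, hj⟩, rMap, MvPolynomial.aeval_X]

/-- The divisor axiom for `⟨H, H^j, τ_d H_r⟩`. -/
theorem bracket_divisor {j d r : ℕ} (h : r < j + d + 1) :
    bracket [(0, 1), (0, j)] d r = ((j + d + 1 - r : ℕ) : GW) * bracket [(0, j)] d r +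
      if d = 0 ∨ r = 0 then 0 else bracket [(0, j)] (d - 1) (r - 1) := by
  have hdeg : (GWSymbol.mk [(0, 1), (0, j)] d r).deg = ((j + d + 1 - r : ℕ) : ℤ) := by
    simp [GWSymbol.deg, weight]
    omega
  have := mk_eq_of_rel (GWRel.divisor [(0, j)] d r (by rw [hdeg]; omega))
  rw [hdeg] at this
  rw [bracket, this]
  by_cases hc : d = 0 ∨ r = 0 <;> simp [bracket, hc]

/-- Topological recursion for `⟨H, H^j, τ_{d+1} H_r⟩`. -/
theorem bracket_recursion (j d r : ℕ) :
    bracket [(0, 1), (0, j)] (d + 1) r = bracket [(0, j + 1)] d r +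
      ∑ i : Fin (j + 1), rMap (aElt i j) * bracket [(0, i)] d r := by
  have := mk_eq_of_rel (GWRel.trrLower [] 0 1 0 j d r)
  simp only [List.nil_append, List.length_nil, Finset.univ_unique, Finset.sum_singleton,
    map_sum, map_mul] at this
  rw [bracket, this]
  have hw : weight [(0, 1), (0, j)] + 3 = j + 1 + 1 + 1 + 1 := by simp [weight]; ring
  rw [hw]
  change ∑ a ∈ Finset.range (j + 1 + 1 + 1 + 1),
    bracket [(0, 1), (0, j)] 0 a * bracket [(0, a)] d r = _
  rw [Finset.sum_range_succ, Finset.sum_range_succ, Finset.sum_range_succ,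
    bracket_three_eq_zero (r := j + 1 + 1) (by omega),
    bracket_three_eq_zero (r := j + 1 + 1 + 1) (by omega), bracket_three_eq_one,
    zero_mul, zero_mul, one_mul, add_zero, add_zero, add_comm, Finset.sum_range]
  congr 1
  refine Finset.sum_congr rfl fun i _ => ?_
  rw [rMap_aElt (Nat.lt_succ_iff.1 i.2)]

/-- The coefficient of `q^e h^r` in `h^j + ∑ ⟨H^j, τ_d H_r⟩ q^{j+d-r+1} h^r`. -/
def gwCoeff (e r j : ℕ) : GW :=
  if e = 0 then if r = j then 1 else 0
  else if j < e + r then bracket [(0, j)] (e + r - j - 1) r else 0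

/-- The two-point series of the Gromov-Witten ring form a fundamental system: evaluate
`⟨H, H^j, τ_d H_r⟩` by the divisor axiom and by the topological recursion. -/
theorem isFundamental_gwCoeff : IsFundamental (fun i j => rMap (aElt i j)) gwCoeff where
  zero r j := by rw [gwCoeff, if_pos rfl]
  vanish e r j he hj := by rw [gwCoeff, if_neg he.ne', if_neg (by omega)]
  eqn e r j he hj := by
    obtain ⟨d, hd⟩ := Nat.exists_eq_add_of_lt hj
    have hdiv := bracket_divisor (j := j) (d := d) (r := r) (by omega)
    rw [show j + d + 1 - r = e by omega] at hdiv
    have h1 : gwCoeff e r j = bracket [(0, j)] d r := by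
      rw [gwCoeff, if_neg he.ne', if_pos hj, show e + r - j - 1 = d by omega]
    have h2 : (if r = 0 then 0 else gwCoeff e (r - 1) j) =
        if d = 0 ∨ r = 0 then 0 else bracket [(0, j)] (d - 1) (r - 1) := by
      rw [gwCoeff, if_neg he.ne']
      split_ifs <;> first
        | rfl
        | omega
        | rw [show e + (r - 1) - j - 1 = d - 1 by omega]
    rw [h1, h2, ← hdiv]
    cases d with
    | zero =>
      have h3 : gwCoeff e r (j + 1) = 0 := by rw [gwCoeff, if_neg he.ne', if_neg (by omega)]
      -- For `d = 0` only the initial term `h^r` of the `r`-th series contributes to the sum.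
      rw [h3, zero_add, Finset.sum_eq_single ⟨r, by omega⟩]
      · rw [if_pos (by simp only; omega), gwCoeff, if_pos (by simp only; omega), if_pos rfl,
          mul_one, rMap_aElt (by simp only; omega)]
      · intro i _ hi
        have hi' : (i : ℕ) ≠ r := fun h => hi (Fin.ext h)
        have := i.2
        split_ifs with hle
        · rw [gwCoeff]
          split_ifs <;> first | omega | rw [mul_zero]
        · rfl
      · simp
    | succ d =>
      have h3 : gwCoeff e r (j + 1) = bracket [(0, j + 1)] d r := by
        rw [gwCoeff, if_neg he.ne', if_pos (by omega), show e + r - (j + 1) - 1 = d by omega]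
      rw [h3, bracket_recursion]
      congr 1
      refine Finset.sum_congr rfl fun i _ => ?_
      have := i.2
      rw [gwCoeff]
      split_ifs with ha hb hc hd <;> first
        | omega
        | rw [show e - (j + 1 - i) + r - i - 1 = d by omega]
        | rw [bracket_two_eq_zero (by omega)]
      rw [mul_zero]

theorem iGW_eq_toSeries : iGW = toSeries gwCoeff 0 := by
  have hs : ∀ d r, bracket [(0, 0)] d r = if d = 0 then 0 else bracket [] (d - 1) r := by
    intro d r
    have := mk_eq_of_rel (GWRel.string [] d r (by simp))
    rw [bracket, this]
    by_cases hc : d = 0 <;> simp [bracket, hc]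
  ext r e
  rw [iGW, iSeries, toSeries, PowerSeries.coeff_mk, PowerSeries.coeff_mk, map_add, map_add,
    PowerSeries.coeff_mk, PowerSeries.coeff_mk, PowerSeries.coeff_one, gwCoeff]
  rcases Nat.eq_zero_or_pos e with rfl | he
  · simp only [lt_irrefl, false_and, if_false, if_true, add_zero]
    split_ifs <;> simp
  · have h1 : PowerSeries.coeff e (if r = 0 then 1 else 0 : GW⟦X⟧) = 0 := by
      split_ifs <;> simp [PowerSeries.coeff_one, he.ne']
    rw [h1, zero_add, if_neg he.ne', if_pos (show 0 < e + r by omega), hs]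
    split_ifs <;> first
      | omega
      | rfl

theorem aGWN_eq_zero {N i j : ℕ} (hij : i ≤ j) (hj : N < j) : aGWN N i j = 0 := by
  rw [aGWN, rMap_aElt hij]
  exact Ideal.Quotient.eq_zero_iff_mem.2 (Ideal.subset_span ⟨i, j, hij, hj, rfl⟩)

end GWRing

/-! ### The universal series -/

theorem aN_eq_zero {N i j : ℕ} (hij : i ≤ j) (hj : N < j) : aN N i j = 0 := by
  rw [aN, aElt, dif_pos ⟨hij, by omega⟩, rN, MvPolynomial.aeval_X, dif_neg (by simp only; omega)]

/-- An element of `A` is determined by its restrictions to all `A_N` with `N` large. -/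
theorem eq_zero_of_forall_rN {x : A} (k : ℕ) (h : ∀ N, k ≤ N → rN N x = 0) : x = 0 := by
  obtain ⟨N, hkN, hN⟩ : ∃ N, k ≤ N ∧ ∀ p ∈ x.vars, p.1.2 ≤ N :=
    ⟨max k (x.vars.sup fun p => p.1.2), le_max_left _ _, fun p hp =>
      (Finset.le_sup (f := fun p => p.1.2) hp).trans (le_max_right _ _)⟩
  let s : AN N →ₐ[ℂ] A := MvPolynomial.aeval fun p =>
    MvPolynomial.X ⟨p.1, p.2.1, p.2.2.1⟩
  have hs : (s.comp (rN N)).toRingHom x = RingHom.id A x := by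
    refine MvPolynomial.hom_congr_vars ?_ (fun p hp _ => ?_) rfl
    · ext c
      simp
    · change s (rN N (MvPolynomial.X p)) = MvPolynomial.X p
      rw [rN, MvPolynomial.aeval_X, dif_pos (hN p hp)]
      simp [s]
  change s (rN N x) = x at hs
  rw [← hs, h N hkN, map_zero]

/-- The universal series: the first member of the fundamental system with the letters `a_ij` of
`A` as coefficients. -/
def universalSeries : A⟦X⟧⟦X⟧ := toSeries (fundamental aElt) 0

theorem mapSeries_rMap_universalSeries : mapSeries rMap.toRingHom universalSeries = iGW := by
  rw [universalSeries, mapSeries_toSeries, iGW_eq_toSeries,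
    isFundamental_gwCoeff.unique ((isFundamental_fundamental aElt).map rMap.toRingHom)]

end MinGW

end

open MinGW in
theorem theorem3p4 :
    (∀ N : ℕ,
      IsPerturbedSolution (N + 1) (opLQ (aGWN N) N) (mapSeries (toGWN N).toRingHom iGW) ∧
      IsPerturbedSolution N (opL (aGWN N) N)
        (mapSeries (toGWN N).toRingHom (regularize iGW)) ∧
      IsSolutionBasis (opL (aGWN N) N)
        (fun k : Fin N => mapLog (toGWN N).toRingHom (pert (regularize iGW) k))) ∧
    ∃! U : PowerSeries (PowerSeries A),
      (∀ j, PowerSeries.constantCoeff (PowerSeries.coeff j U) = if j = 0 then 1 else 0) ∧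
      mapSeries rMap.toRingHom U = iGW ∧
      ∀ N : ℕ,
        IsPerturbedSolution (N + 1) (opLQ (aN N) N) (mapSeries (rN N).toRingHom U) ∧
        IsPerturbedSolution N (opL (aN N) N) (mapSeries (rN N).toRingHom (regularize U)) ∧
        IsSolutionBasis (opL (aN N) N)
          (fun k : Fin N => mapLog (rN N).toRingHom (pert (regularize U) k)) := by
  have hU : ∀ N, _ := fun N => (isFundamental_fundamental aElt).solutions_map (rN N)
    (b := aN N) (fun _ _ => rfl) (N := N) fun _ _ => aN_eq_zero
  have hconst : ∀ j, PowerSeries.constantCoeff (PowerSeries.coeff j universalSeries) =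
      if j = 0 then 1 else 0 := fun j => by
    rw [← PowerSeries.coeff_zero_eq_constantCoeff_apply, ← coeff_qCoeff, universalSeries,
      coeff_qCoeff_toSeries, (isFundamental_fundamental aElt).zero]
  refine ⟨fun N => ?_, universalSeries, ⟨hconst, mapSeries_rMap_universalSeries, hU⟩, ?_⟩
  · rw [iGW_eq_toSeries]
    have h := isFundamental_gwCoeff.solutions_map (toGWN N) (b := aGWN N) (fun _ _ => rfl)
      (N := N) fun _ _ => aGWN_eq_zero
    exact h
  · rintro V ⟨hV0, -, hV⟩
    refine PowerSeries.ext fun k => PowerSeries.ext fun d => ?_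
    rw [← sub_eq_zero]
    refine eq_zero_of_forall_rN k fun N hN => ?_
    have h0 : qCoeff 0 V = qCoeff 0 universalSeries := by
      ext j
      rw [coeff_qCoeff, coeff_qCoeff, PowerSeries.coeff_zero_eq_constantCoeff_apply,
        PowerSeries.coeff_zero_eq_constantCoeff_apply, hV0, hconst]
    have h1 := coeff_eq_of_isPerturbedSolution (hV N).1 (hU N).1
      (by rw [qCoeff_mapSeries, qCoeff_mapSeries, h0]; rfl) hN
    have h2 := congrArg (PowerSeries.coeff d) h1
    simp only [PowerSeries.coeff_map] at h2
    rw [map_sub, sub_eq_zero]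
    exact h2
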